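/- \textbf{Conventions.} Hyperbolic space is $\mathbb{H}^3=\{(\zeta,w)\in\mathbb{C}\times\mathbb{R}: w>0\}$ with the metric $(|d\zeta|^2+dw^2)/w^2$. It is identified with the positive definite Hermitian $2\times 2$ matrices $N$ of determinant $1$ by $\zeta=N_{21}/N_{11}$, $w=1/N_{11}$. The direct isometries are $N\mapsto PNP^*$ with $P\in \mathrm{SL}_2(\mathbb{C})$. The indirect ones are their compositions with $(\zeta,w)\mapsto(\bar\zeta,w)$. A \emph{Bryant surface} is a smooth conformal immersion $X:M\to\mathbb{H}^3$ of a Riemann surface $M$ with mean curvature (half the trace of the second fundamental form) constant equal to $1$ with respect to the unit normal $N$ for which $(X_x,X_y,N)$ is direct, $z=x+iy$ being a local coordinate of $M$. Ends of $M$ are annular and conformally parametrized by a punctured disc $\Omega^*=\{0<|z|<r\}$; two parametrizations that agree on the germ of neighbourhoods of the puncture define the same end. A \emph{$2$-catenoidal surface} is a complete Bryant surface with exactly two ends, each of which is embedded and of finite total curvature. A \emph{Bryant representation} with Weierstrass data $(g,\omega)$ on $\Omega^*$ is a (multivalued) holomorphic map $F:\Omega^*\to \mathrm{SL}_2(\mathbb{C})$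 with $F^{-1}dF=\begin{pmatrix} g&-g^2\\1&-g\end{pmatrix}\omega$; when $FF^*$ is single-valued it defines an end in $\mathbb{H}^3$. Below, $f_1,f_2,g_1,g_2,h$ are holomorphic near $0$ with $f_1(0)=f_2(0)=g_1(0)=g_2(0)=1$ and $h(0)\neq0$. The \emph{canonical catenoidal ends} of growth $1-\mu$ ($\mu>0$, $\mu\ne1$) and axis $(0,\infty)$ are the ends $FF^*$ with $g=z^\mu$, $\omega=z^{-1-\mu}h\,dz$, $f_1'(0)=0$ and $$F=\begin{pmatrix} z^{\frac{1-\mu}{2}}f_2 & \frac{\mu-1}{\mu+1}z^{\frac{1+\mu}{2}}g_2\\ \frac{\mu^2-1}{4\mu}z^{\frac{-1-\mu}{2}}f_1 & \frac{(1+\mu)^2}{4\mu}z^{\frac{\mu-1}{2}}g_1\end{pmatrix}.$$ The \emph{canonical horospherical ends} are the ends $FF^*$ with $g=z^\mu$, $\omega=z^{-2}h\,dz$, $\mu\geq2$ an integer, and $$F=\begin{pmatrix} f_2 & b z^{2\mu-1}g_2\\ c z^{-1}f_1 & g_1\end{pmatrix},\qquad b,c\in\mathbb{C}^*.$$ An embedded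 end of finite total curvature that is not part of a horosphere is a \emph{catenoidal end} (respectively a \emph{horospherical end}) if some isometry of $\mathbb{H}^3$, direct or not, maps it to a canonical catenoidal end of some growth $1-\mu$ and axis $(0,\infty)$ (respectively to a canonical horospherical end). \textbf{Proposition.} There is no $2$-catenoidal surface with one catenoidal end and one horospherical end. -/

import Mathlib

open scoped Manifold ContDiff Topology Laplacian

noncomputable section

namespace BryantFlux

/-! ### Hyperbolic 3-space, upper half-space model

A point is a pair `(ζ, w) : ℂ × ℝ` with `0 < w`; the metric is `(|dζ|² + dw²) / w²`. -/

/-- The upper half-space `{(ζ, w) | w > 0}`. -/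
def halfSpace : Set (ℂ × ℝ) := {p | 0 < p.2}

/-- Euclidean inner product of two vectors of `ℂ × ℝ = ℝ³`. -/
def eucInner (u v : ℂ × ℝ) : ℝ := (starRingEnd ℂ u.1 * v.1).re + u.2 * v.2

/-- Hyperbolic inner product of two tangent vectors at `p`. -/
def hypInner (p u v : ℂ × ℝ) : ℝ := eucInner u v / p.2 ^ 2

/-- Euclidean cross product in the coordinates `(Re ζ, Im ζ, w)`. -/
def cross (u v : ℂ × ℝ) : ℂ × ℝ :=
  (⟨u.1.im * v.2 - u.2 * v.1.im, u.2 * v.1.re - u.1.re * v.2⟩,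
    u.1.re * v.1.im - u.1.im * v.1.re)

/-- The Christoffel symbols `Γ_p(u, v)` of the Levi-Civita connection of the metric
`(|dζ|² + dw²) / w²`, in the coordinates `(ζ, w)`. -/
def christoffel (p u v : ℂ × ℝ) : ℂ × ℝ :=
  p.2⁻¹ • (((0 : ℂ), eucInner u v) - u.2 • v - v.2 • u)

/-! ### Local geometry of a parametrized surface `Y = (ζ, w)` in half-space -/

/-- First derivative in the direction `a` of the parameter plane (`a = 1` is `∂/∂x`,
`a = I` is `∂/∂y`). -/
def partialD (Y : ℂ → ℂ × ℝ) (a z : ℂ) : ℂ × ℝ := fderiv ℝ Y z a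

/-- The covariant derivative `∇_a (∂_b Y)` in hyperbolic space along the surface `Y`. -/
def covD (Y : ℂ → ℂ × ℝ) (a b z : ℂ) : ℂ × ℝ :=
  fderiv ℝ (partialD Y b) z a + christoffel (Y z) (partialD Y a z) (partialD Y b z)

/-- Coefficients of the first fundamental form. -/
def firstFF (Y : ℂ → ℂ × ℝ) (a b z : ℂ) : ℝ :=
  hypInner (Y z) (partialD Y a z) (partialD Y b z)

/-- The hyperbolic unit normal `N` such that `(∂_x Y, ∂_y Y, N)` is a direct basis. -/
def unitNormal (Y : ℂ → ℂ × ℝ) (z : ℂ) : ℂ × ℝ :=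
  let c := cross (partialD Y 1 z) (partialD Y Complex.I z)
  (Real.sqrt (hypInner (Y z) c c))⁻¹ • c

/-- Coefficients of the second fundamental form. -/
def secondFF (Y : ℂ → ℂ × ℝ) (a b z : ℂ) : ℝ :=
  hypInner (Y z) (covD Y a b z) (unitNormal Y z)

/-- The mean curvature: half of the trace of the second fundamental form with respect to the
first one. -/
def meanCurvature (Y : ℂ → ℂ × ℝ) (z : ℂ) : ℝ :=
  (secondFF Y 1 1 z * firstFF Y Complex.I Complex.I z
      - 2 * (secondFF Y 1 Complex.I z * firstFF Y 1 Complex.I z)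
      + secondFF Y Complex.I Complex.I z * firstFF Y 1 1 z)
    / (2 * (firstFF Y 1 1 z * firstFF Y Complex.I Complex.I z - firstFF Y 1 Complex.I z ^ 2))

/-- `Y` is a conformal immersion at `z`: the induced metric there is `λ |dz|²` with `λ > 0`. -/
def IsConformalImmersionAt (Y : ℂ → ℂ × ℝ) (z : ℂ) : Prop :=
  0 < firstFF Y 1 1 z ∧ firstFF Y Complex.I Complex.I z = firstFF Y 1 1 z ∧
    firstFF Y 1 Complex.I z = 0

/-- Gaussian curvature of the induced metric `λ |dz|²` of a conformal immersion:
`K = - Δ (log λ) / (2 λ)`. -/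
def gaussCurvature (Y : ℂ → ℂ × ℝ) (z : ℂ) : ℝ :=
  - (Δ (fun ξ : ℂ => Real.log (firstFF Y 1 1 ξ))) z / (2 * firstFF Y 1 1 z)

/-! ### The Hermitian (Minkowski) model and isometries -/

/-- The point `(ζ, w)` as a Hermitian matrix of determinant one. -/
def toHerm (p : ℂ × ℝ) : Matrix (Fin 2) (Fin 2) ℂ :=
  !![(p.2 : ℂ)⁻¹, starRingEnd ℂ p.1 * (p.2 : ℂ)⁻¹;
     p.1 * (p.2 : ℂ)⁻¹, ((Complex.normSq p.1 + p.2 ^ 2 : ℝ) : ℂ) * (p.2 : ℂ)⁻¹]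

/-- The inverse identification, `ζ = N₂₁ / N₁₁` and `w = 1 / N₁₁`. -/
def ofHerm (N : Matrix (Fin 2) (Fin 2) ℂ) : ℂ × ℝ := (N 1 0 / N 0 0, ((N 0 0).re)⁻¹)

/-- The direct isometry `N ↦ P N P*` of hyperbolic space, `P ∈ SL₂(ℂ)`. -/
def directIsometry (P : Matrix.SpecialLinearGroup (Fin 2) ℂ) (p : ℂ × ℝ) : ℂ × ℝ :=
  ofHerm ((P : Matrix (Fin 2) (Fin 2) ℂ) * toHerm p * (P : Matrix (Fin 2) (Fin 2) ℂ).conjTranspose)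

/-- The reflection `(ζ, w) ↦ (conj ζ, w)`. The indirect isometries are the maps
`directIsometry P ∘ reflection`. -/
def reflection (p : ℂ × ℝ) : ℂ × ℝ := (starRingEnd ℂ p.1, p.2)

/-- The immersion `F F*` in half-space coordinates:
`ζ = (conj A C + conj B D) / (|A|² + |B|²)`, `w = 1 / (|A|² + |B|²)`. -/
def bryantMap (F : ℂ → Matrix (Fin 2) (Fin 2) ℂ) (z : ℂ) : ℂ × ℝ :=
  ofHerm (F z * (F z).conjTranspose)

/-! ### Canonical ends -/

/-- The punctured disc `0 < |z| < r`. -/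
def puncturedDisc (r : ℝ) : Set ℂ := Metric.ball 0 r \ {0}

/-- `F` is (a branch of) a Bryant representation on the punctured disc with Weierstrass data
`(g, ω = w dz)`: `F` is holomorphic off the branch cut, `det F = 1` and
`F⁻¹ dF = (g, -g²; 1, -g) ω`. The functions `F`, `g`, `w` are multivalued on the punctured disc;
they are given by their principal branches, which are holomorphic on the slit plane. -/
def IsBryantRepresentation (F : ℂ → Matrix (Fin 2) (Fin 2) ℂ) (g w : ℂ → ℂ) (r : ℝ) : Prop :=
  (∀ z ∈ puncturedDisc r, (F z).det = 1) ∧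
  ∀ z ∈ puncturedDisc r ∩ Complex.slitPlane, ∀ i j : Fin 2,
    HasDerivAt (fun ξ => F ξ i j)
      ((F z * (w z • !![g z, -(g z) ^ 2; 1, -(g z)])) i j) z

/-- `F` is the canonical Bryant representation, on the punctured disc of radius `r`, of a
canonical catenoidal end of growth `1 - μ` and axis `(Z, ∞)`; its Weierstrass data are
`g = z ^ μ`, `ω = z ^ (-1 - μ) h dz`. -/
def IsCanonicalCatenoidal (μ : ℝ) (Z : ℂ) (r : ℝ) (F : ℂ → Matrix (Fin 2) (Fin 2) ℂ) : Prop :=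
  0 < μ ∧ μ ≠ 1 ∧
  ∃ f₁ f₂ g₁ g₂ h : ℂ → ℂ,
    (DifferentiableOn ℂ f₁ (Metric.ball 0 r) ∧ DifferentiableOn ℂ f₂ (Metric.ball 0 r) ∧
      DifferentiableOn ℂ g₁ (Metric.ball 0 r) ∧ DifferentiableOn ℂ g₂ (Metric.ball 0 r) ∧
      DifferentiableOn ℂ h (Metric.ball 0 r)) ∧
    (f₁ 0 = 1 ∧ f₂ 0 = 1 ∧ g₁ 0 = 1 ∧ g₂ 0 = 1 ∧ h 0 ≠ 0) ∧
    Z = ((μ : ℂ) ^ 2 - 1) / (4 * μ) * deriv f₁ 0 ∧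
    (∀ z ∈ puncturedDisc r, F z =
      !![z ^ ((1 - (μ : ℂ)) / 2) * f₂ z,
         ((μ : ℂ) - 1) / (μ + 1) * z ^ ((1 + (μ : ℂ)) / 2) * g₂ z;
         ((μ : ℂ) ^ 2 - 1) / (4 * μ) * z ^ ((-1 - (μ : ℂ)) / 2) * f₁ z,
         (1 + (μ : ℂ)) ^ 2 / (4 * μ) * z ^ (((μ : ℂ) - 1) / 2) * g₁ z]) ∧
    IsBryantRepresentation F (fun z => z ^ (μ : ℂ)) (fun z => z ^ (-1 - (μ : ℂ)) * h z) r

/-- `F` is the canonical Bryant representation, on the punctured disc of radius `r`, of a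
canonical horospherical end with asymptotic boundary `∞`; its Weierstrass data are
`g = z ^ μ`, `ω = z ^ (-2) h dz`, with `μ ≥ 2` an integer. -/
def IsCanonicalHorospherical (μ : ℕ) (r : ℝ) (F : ℂ → Matrix (Fin 2) (Fin 2) ℂ) : Prop :=
  2 ≤ μ ∧
  ∃ (f₁ f₂ g₁ g₂ h : ℂ → ℂ) (b c : ℂ),
    (DifferentiableOn ℂ f₁ (Metric.ball 0 r) ∧ DifferentiableOn ℂ f₂ (Metric.ball 0 r) ∧
      DifferentiableOn ℂ g₁ (Metric.ball 0 r) ∧ DifferentiableOn ℂ g₂ (Metric.ball 0 r) ∧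
      DifferentiableOn ℂ h (Metric.ball 0 r)) ∧
    (f₁ 0 = 1 ∧ f₂ 0 = 1 ∧ g₁ 0 = 1 ∧ g₂ 0 = 1 ∧ h 0 ≠ 0) ∧
    b ≠ 0 ∧ c ≠ 0 ∧
    (∀ z ∈ puncturedDisc r, F z =
      !![f₂ z, b * z ^ (2 * μ - 1) * g₂ z;
         c * z⁻¹ * f₁ z, g₁ z]) ∧
    IsBryantRepresentation F (fun z => z ^ μ) (fun z => (z ^ 2)⁻¹ * h z) r

/-! ### Bryant surfaces and their ends -/

section Surface

variable {M : Type*} [TopologicalSpace M] [ChartedSpace ℂ M]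

/-- `X` is a Bryant immersion of the Riemann surface `M`: a smooth conformal immersion into
hyperbolic space with constant mean curvature one. -/
structure IsBryantImmersion (X : M → ℂ × ℝ) : Prop where
  mem_halfSpace : ∀ p, X p ∈ halfSpace
  smooth : ContMDiff 𝓘(ℝ, ℂ) 𝓘(ℝ, ℂ × ℝ) ∞ X
  conformal : ∀ c ∈ atlas ℂ M, ∀ z ∈ c.target, IsConformalImmersionAt (X ∘ c.symm) z
  meanCurvature_eq_one : ∀ c ∈ atlas ℂ M, ∀ z ∈ c.target, meanCurvature (X ∘ c.symm) z = 1

/-- The hyperbolic speed of the curve `X ∘ γ`. -/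
def hypSpeed (X : M → ℂ × ℝ) (γ : ℝ → M) (t : ℝ) : ℝ :=
  Real.sqrt (hypInner (X (γ t)) (deriv (X ∘ γ) t) (deriv (X ∘ γ) t))

/-- Completeness of the metric induced by `X`: every `C¹` half-open curve in `M` of finite length
converges in `M`. -/
def IsCompleteSurface (X : M → ℂ × ℝ) : Prop :=
  ∀ γ : ℝ → M, ContMDiffOn 𝓘(ℝ, ℝ) 𝓘(ℝ, ℂ) 1 γ (Set.Ici 0) →
    MeasureTheory.IntegrableOn (hypSpeed X γ) (Set.Ici 0) →
    ∃ p : M, Filter.Tendsto γ Filter.atTop (𝓝 p)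

/-- `φ` is a conformal parametrization by the punctured disc of radius `r` of the (annular) end
`e` of `M`. An end is recorded by the filter of its neighbourhoods, i.e. of the subsets of `M` that
contain all points close enough to the puncture; `e ≤ cocompact M` says that points tending to the
puncture leave every compact subset of `M`. -/
structure IsEndParam (e : Filter M) (φ : ℂ → M) (r : ℝ) : Prop where
  radius_pos : 0 < r
  injOn : Set.InjOn φ (puncturedDisc r)
  holomorphic : MDifferentiableOn 𝓘(ℂ) 𝓘(ℂ) φ (puncturedDisc r)
  map_eq : Filter.map φ (𝓝[≠] (0 : ℂ)) = e
  le_cocompact : e ≤ Filter.cocompact M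

/-- The end `e` of the surface `X` is an embedded end of finite total curvature: some annular
neighbourhood of it is embedded, and has finite `∫ |K| dA`
(the area element is `dA = λ dx dy` where `λ |dz|²` is the induced metric). -/
def IsEmbeddedFiniteTotalCurvatureEnd (X : M → ℂ × ℝ) (e : Filter M) : Prop :=
  ∃ (φ : ℂ → M) (r : ℝ), IsEndParam e φ r ∧
    Topology.IsEmbedding ((puncturedDisc r).domRestrict (X ∘ φ)) ∧
    MeasureTheory.IntegrableOn
      (fun z => gaussCurvature (X ∘ φ) z * firstFF (X ∘ φ) 1 1 z) (puncturedDisc r)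

/-- A neighbourhood of the end `e` lies in a horosphere; every horosphere is the image of
`{w = 1}` under a direct isometry. -/
def IsPartOfHorosphere (X : M → ℂ × ℝ) (e : Filter M) : Prop :=
  ∃ P : Matrix.SpecialLinearGroup (Fin 2) ℂ, ∀ᶠ p in e, (directIsometry P (X p)).2 = 1

/-- Some isometry of hyperbolic space, direct or not, maps the end `e` of `X` to the end
`F F*` defined on the punctured disc of radius `r`. An indirect isometry reverses the orientation,
so that the conformal parameter of the image is the conjugate of the one of `M`. -/
def IsIsometricToEnd (X : M → ℂ × ℝ) (e : Filter M) (F : ℂ → Matrix (Fin 2) (Fin 2) ℂ)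
    (r : ℝ) : Prop :=
  ∃ (P : Matrix.SpecialLinearGroup (Fin 2) ℂ) (φ : ℂ → M), IsEndParam e φ r ∧
    ((∀ z ∈ puncturedDisc r, directIsometry P (X (φ z)) = bryantMap F z) ∨
     (∀ z ∈ puncturedDisc r,
        directIsometry P (reflection (X (φ z))) = bryantMap F (starRingEnd ℂ z)))

/-- Catenoidal ends: embedded ends of finite total curvature, not part of a horosphere, which some
isometry maps to a canonical catenoidal end of axis `(0, ∞)` (of some growth `1 - μ`). -/
def IsCatenoidalEnd (X : M → ℂ × ℝ) (e : Filter M) : Prop :=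
  IsEmbeddedFiniteTotalCurvatureEnd X e ∧ ¬ IsPartOfHorosphere X e ∧
  ∃ (μ r : ℝ) (F : ℂ → Matrix (Fin 2) (Fin 2) ℂ),
    IsCanonicalCatenoidal μ 0 r F ∧ IsIsometricToEnd X e F r

/-- Horospherical ends: embedded ends of finite total curvature, not part of a horosphere, which
some isometry maps to a canonical horospherical end. -/
def IsHorosphericalEnd (X : M → ℂ × ℝ) (e : Filter M) : Prop :=
  IsEmbeddedFiniteTotalCurvatureEnd X e ∧ ¬ IsPartOfHorosphere X e ∧
  ∃ (μ : ℕ) (r : ℝ) (F : ℂ → Matrix (Fin 2) (Fin 2) ℂ),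
    IsCanonicalHorospherical μ r F ∧ IsIsometricToEnd X e F r

/-- `X : M → ℍ³` is an `n`-catenoidal surface with ends `e 0, …, e (n - 1)`: a complete Bryant
surface with exactly these `n` distinct ends (the equality with `cocompact M` says that the
complement of any union of neighbourhoods of the ends is relatively compact), each of which is an
embedded end of finite total curvature. -/
structure IsCatenoidalSurface (n : ℕ) (X : M → ℂ × ℝ) (e : Fin n → Filter M) : Prop where
  bryant : IsBryantImmersion X
  complete : IsCompleteSurface X
  ends_disjoint : Pairwise (fun i j => Disjoint (e i) (e j))
  ends_exhaust : Filter.cocompact M = ⨆ i, e i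
  embedded_ftc : ∀ i, IsEmbeddedFiniteTotalCurvatureEnd X (e i)

end Surface

end BryantFlux

end

noncomputable section

namespace BryantFlux

open MeasureTheory Set Metric Filter

open scoped Matrix

/-! Let `N` be the surface in the Hermitian model. The proof rests on a conservation law: the
matrix-valued flux form `N_z N⁻¹ dz` is holomorphic on `M`. Indeed, in half-space coordinates a
conformal immersion of mean curvature one (for the chosen normal) satisfies `w ζ_{z z̄} = 2 w_z
ζ_z̄` and `w w_{z z̄} = |w_z|² - |ζ_z̄|²`, and these equations kill `∂̄` of each entry
(`wirtinger_equations`, `differentiableOn_fluxForm`). The form is built from `N` itself, so it is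
single-valued on `M` and no global Bryant representation is required.

At each end the form has at most a double pole. The residue theorem (`sum_residue_eq_zero`) makes
the residue matrices at the two ends opposite, and opposite `2 × 2` matrices have the same
determinant.

Whether this determinant vanishes depends only on the isometry class of the end: a direct isometry
conjugates the residue by a constant matrix of `SL₂(ℂ)`, and the reflection replaces it by its
complex conjugate (`exists_hasFluxResidue_of_isometric`). It is therefore enough to look at
canonical ends, where `N = F F*` and the form is `dF F⁻¹`. At a canonical catenoidal end the residue
is lower triangular with diagonal `μ h(0), -μ h(0)`, so its determinant `-(μ h(0))²` is not zero. At
a canonical horospherical end the residue is strictly lower triangular, so its determinant is zero.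
The two types of ends cannot coexist.

The residue theorem comes from a cutoff argument. For a smooth `χ` equal to `1` on a compact core
and to `0` near the punctures, Stokes' theorem gives `∫ ∂̄χ ∧ α = 0`. The integrand lives in the
ends, and each end contributes `π` times its residue (`integral_wirtingerBar_mul_div_sq`). Integrals
over `M` are handled as sums of weighted integrals over charts. -/

/-! ### Wirtinger derivatives -/

/-- The Wirtinger derivative `∂f/∂z`. -/
def wirtinger (f : ℂ → ℂ) (z : ℂ) : ℂ :=
  (fderiv ℝ f z 1 - Complex.I * fderiv ℝ f z Complex.I) / 2

/-- The Wirtinger derivative `∂f/∂z̄`. -/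
def wirtingerBar (f : ℂ → ℂ) (z : ℂ) : ℂ :=
  (fderiv ℝ f z 1 + Complex.I * fderiv ℝ f z Complex.I) / 2

/-- A real-linear map of `ℂ` has the form `v ↦ A v + B v̄`, and the Wirtinger derivatives are its
two coefficients. The chain rules for a holomorphic inner map follow from this. -/
theorem fderiv_apply_eq_wirtinger (f : ℂ → ℂ) (z v : ℂ) :
    fderiv ℝ f z v = wirtinger f z * v + wirtingerBar f z * starRingEnd ℂ v := by
  have hv : v = v.re • (1 : ℂ) + v.im • Complex.I := by
    simp [Complex.re_add_im]
  have h1 : fderiv ℝ f z v = v.re * fderiv ℝ f z 1 + v.im * fderiv ℝ f z Complex.I := by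
    conv_lhs => rw [hv]
    rw [map_add, map_smul, map_smul]; simp
  have h2 : starRingEnd ℂ v = v.re - v.im * Complex.I := by
    apply Complex.ext <;> simp
  have h3 : v = v.re + v.im * Complex.I := (Complex.re_add_im v).symm
  rw [h1, h2]
  conv_rhs => rw [h3]
  simp only [wirtinger, wirtingerBar, Complex.add_re, Complex.ofReal_re, Complex.mul_re,
    Complex.I_re, Complex.ofReal_im, Complex.I_im, Complex.add_im, Complex.mul_im]
  ring_nf
  simp only [Complex.I_sq]
  ring

theorem wirtingerBar_eq_zero {f : ℂ → ℂ} {z : ℂ} (hf : DifferentiableAt ℂ f z) :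
    wirtingerBar f z = 0 := by
  have := (differentiableAt_complex_iff_differentiableAt_real.1 hf).2
  rw [wirtingerBar, this, smul_eq_mul, ← mul_assoc, Complex.I_mul_I]; ring

theorem wirtinger_eq_deriv {f : ℂ → ℂ} {z : ℂ} (hf : DifferentiableAt ℂ f z) :
    wirtinger f z = deriv f z := by
  have := (differentiableAt_complex_iff_differentiableAt_real.1 hf).2
  rw [wirtinger, this, smul_eq_mul, ← mul_assoc, Complex.I_mul_I, hf.fderiv_restrictScalars ℝ]
  simp

theorem differentiableAt_of_wirtingerBar_eq_zero {f : ℂ → ℂ} {z : ℂ}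
    (hf : DifferentiableAt ℝ f z) (h : wirtingerBar f z = 0) : DifferentiableAt ℂ f z := by
  refine differentiableAt_complex_iff_differentiableAt_real.2 ⟨hf, ?_⟩
  have h' : fderiv ℝ f z 1 + Complex.I * fderiv ℝ f z Complex.I = 0 := by
    simpa [wirtingerBar] using h
  rw [smul_eq_mul]
  linear_combination -Complex.I * h' + fderiv ℝ f z Complex.I * Complex.I_mul_I

theorem wirtinger_congr {f g : ℂ → ℂ} {z : ℂ} (h : f =ᶠ[𝓝 z] g) :
    wirtinger f z = wirtinger g z := by
  rw [wirtinger, wirtinger, h.fderiv_eq]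

theorem wirtingerBar_congr {f g : ℂ → ℂ} {z : ℂ} (h : f =ᶠ[𝓝 z] g) :
    wirtingerBar f z = wirtingerBar g z := by
  rw [wirtingerBar, wirtingerBar, h.fderiv_eq]

theorem wirtinger_mul {f g : ℂ → ℂ} {z : ℂ} (hf : DifferentiableAt ℝ f z)
    (hg : DifferentiableAt ℝ g z) :
    wirtinger (fun ξ => f ξ * g ξ) z = wirtinger f z * g z + f z * wirtinger g z := by
  rw [wirtinger, fderiv_fun_mul hf hg, wirtinger, wirtinger]
  simp only [_root_.add_apply, _root_.smul_apply, smul_eq_mul]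
  ring

theorem wirtingerBar_mul {f g : ℂ → ℂ} {z : ℂ} (hf : DifferentiableAt ℝ f z)
    (hg : DifferentiableAt ℝ g z) :
    wirtingerBar (fun ξ => f ξ * g ξ) z = wirtingerBar f z * g z + f z * wirtingerBar g z := by
  rw [wirtingerBar, fderiv_fun_mul hf hg, wirtingerBar, wirtingerBar]
  simp only [_root_.add_apply, _root_.smul_apply, smul_eq_mul]
  ring

theorem wirtinger_add {f g : ℂ → ℂ} {z : ℂ} (hf : DifferentiableAt ℝ f z)
    (hg : DifferentiableAt ℝ g z) :
    wirtinger (fun ξ => f ξ + g ξ) z = wirtinger f z + wirtinger g z := by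
  rw [wirtinger, fderiv_fun_add hf hg, wirtinger, wirtinger]
  simp only [_root_.add_apply]
  ring

theorem wirtingerBar_add {f g : ℂ → ℂ} {z : ℂ} (hf : DifferentiableAt ℝ f z)
    (hg : DifferentiableAt ℝ g z) :
    wirtingerBar (fun ξ => f ξ + g ξ) z = wirtingerBar f z + wirtingerBar g z := by
  rw [wirtingerBar, fderiv_fun_add hf hg, wirtingerBar, wirtingerBar]
  simp only [_root_.add_apply]
  ring

theorem wirtingerBar_sub {f g : ℂ → ℂ} {z : ℂ} (hf : DifferentiableAt ℝ f z)
    (hg : DifferentiableAt ℝ g z) :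
    wirtingerBar (fun ξ => f ξ - g ξ) z = wirtingerBar f z - wirtingerBar g z := by
  rw [wirtingerBar, fderiv_fun_sub hf hg, wirtingerBar, wirtingerBar]
  simp only [_root_.sub_apply]
  ring

theorem wirtinger_const (c : ℂ) (z : ℂ) : wirtinger (fun _ => c) z = 0 := by
  simp [wirtinger]

theorem wirtingerBar_const (c : ℂ) (z : ℂ) : wirtingerBar (fun _ => c) z = 0 := by
  simp [wirtingerBar]

theorem fderiv_comp_holomorphic {f τ : ℂ → ℂ} {z : ℂ} (hf : DifferentiableAt ℝ f (τ z))
    (hτ : DifferentiableAt ℂ τ z) (v : ℂ) :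
    fderiv ℝ (f ∘ τ) z v = fderiv ℝ f (τ z) (deriv τ z * v) := by
  rw [fderiv_comp z hf (hτ.restrictScalars ℝ), hτ.fderiv_restrictScalars ℝ]
  simp [mul_comm]

theorem wirtinger_comp {f τ : ℂ → ℂ} {z : ℂ} (hf : DifferentiableAt ℝ f (τ z))
    (hτ : DifferentiableAt ℂ τ z) :
    wirtinger (f ∘ τ) z = deriv τ z * wirtinger f (τ z) := by
  rw [wirtinger, fderiv_comp_holomorphic hf hτ, fderiv_comp_holomorphic hf hτ,
    fderiv_apply_eq_wirtinger, fderiv_apply_eq_wirtinger]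
  simp only [map_mul, Complex.conj_I, map_one]
  ring_nf
  simp only [Complex.I_sq]
  ring

theorem wirtingerBar_comp {f τ : ℂ → ℂ} {z : ℂ} (hf : DifferentiableAt ℝ f (τ z))
    (hτ : DifferentiableAt ℂ τ z) :
    wirtingerBar (f ∘ τ) z = starRingEnd ℂ (deriv τ z) * wirtingerBar f (τ z) := by
  rw [wirtingerBar, fderiv_comp_holomorphic hf hτ, fderiv_comp_holomorphic hf hτ,
    fderiv_apply_eq_wirtinger, fderiv_apply_eq_wirtinger]
  simp only [map_mul, Complex.conj_I, map_one]
  ring_nf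
  simp only [Complex.I_sq]
  ring

theorem fderiv_conj {f : ℂ → ℂ} {z : ℂ} (hf : DifferentiableAt ℝ f z) (v : ℂ) :
    fderiv ℝ (fun ξ => starRingEnd ℂ (f ξ)) z v = starRingEnd ℂ (fderiv ℝ f z v) := by
  have := (Complex.conjCLE.toContinuousLinearMap.hasFDerivAt.comp z hf.hasFDerivAt).fderiv
  have h2 : (fun ξ => starRingEnd ℂ (f ξ)) = Complex.conjCLE.toContinuousLinearMap ∘ f := by
    ext; simp
  rw [h2, this]; simp

theorem wirtinger_conj {f : ℂ → ℂ} {z : ℂ} (hf : DifferentiableAt ℝ f z) :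
    wirtinger (fun ξ => starRingEnd ℂ (f ξ)) z = starRingEnd ℂ (wirtingerBar f z) := by
  rw [wirtinger, fderiv_conj hf, fderiv_conj hf, wirtingerBar]
  simp only [map_div₀, map_add, map_mul, Complex.conj_I, map_ofNat]
  ring

theorem wirtingerBar_conj {f : ℂ → ℂ} {z : ℂ} (hf : DifferentiableAt ℝ f z) :
    wirtingerBar (fun ξ => starRingEnd ℂ (f ξ)) z = starRingEnd ℂ (wirtinger f z) := by
  rw [wirtingerBar, fderiv_conj hf, fderiv_conj hf, wirtinger]
  simp only [map_div₀, map_sub, map_mul, Complex.conj_I, map_ofNat]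
  ring

theorem ContDiffOn.continuousOn_wirtingerBar {f : ℂ → ℂ} {U : Set ℂ} (hU : IsOpen U)
    (hf : ContDiffOn ℝ 1 f U) : ContinuousOn (wirtingerBar f) U := by
  have h := hf.continuousOn_fderiv_of_isOpen hU le_rfl
  unfold wirtingerBar
  fun_prop

/-! ### Extension by zero -/

theorem indicator_eventuallyEq_zero {U K : Set ℂ} (hK : IsCompact K) {f : ℂ → ℂ}
    (h0 : ∀ z ∈ U, z ∉ K → f z = 0) {z : ℂ} (hz : z ∉ K) :
    U.indicator f =ᶠ[𝓝 z] fun _ => 0 := by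
  filter_upwards [hK.isClosed.isOpen_compl.mem_nhds hz] with w hw
  by_cases hwU : w ∈ U
  · rw [indicator_of_mem hwU, h0 w hwU hw]
  · rw [indicator_of_notMem hwU]

/-- Near a point of `K` the extension agrees with `f`; off the closed set `K` it vanishes locally.
Integrals over `U` thus become integrals over the plane, where integration by parts has no boundary
term. -/
theorem contDiff_indicator {U K : Set ℂ} (hU : IsOpen U) (hK : IsCompact K) (hKU : K ⊆ U)
    {n : ℕ∞} {f : ℂ → ℂ} (hf : ContDiffOn ℝ n f U) (h0 : ∀ z ∈ U, z ∉ K → f z = 0) :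
    ContDiff ℝ n (U.indicator f) := by
  rw [contDiff_iff_contDiffAt]
  intro z
  by_cases hz : z ∈ K
  · have hzU := hU.mem_nhds (hKU hz)
    refine (hf.contDiffAt hzU).congr_of_eventuallyEq ?_
    filter_upwards [hzU] with w hw using indicator_of_mem hw f
  · exact contDiffAt_const.congr_of_eventuallyEq (indicator_eventuallyEq_zero hK h0 hz)

theorem continuous_indicator_of_compact {U K : Set ℂ} (hU : IsOpen U) (hK : IsCompact K)
    (hKU : K ⊆ U) {f : ℂ → ℂ} (hf : ContinuousOn f U) (h0 : ∀ z ∈ U, z ∉ K → f z = 0) :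
    Continuous (U.indicator f) := by
  have := contDiff_indicator (n := 0) hU hK hKU (by simpa using hf) h0
  exact this.continuous

theorem hasCompactSupport_indicator {U K : Set ℂ} (hK : IsCompact K)
    {f : ℂ → ℂ} (h0 : ∀ z ∈ U, z ∉ K → f z = 0) : HasCompactSupport (U.indicator f) := by
  refine HasCompactSupport.intro hK fun z hz => ?_
  exact (indicator_eventuallyEq_zero hK h0 hz).self_of_nhds

theorem integrableOn_of_compact {U K : Set ℂ} (hU : IsOpen U) (hK : IsCompact K)
    (hKU : K ⊆ U) {f : ℂ → ℂ} (hf : ContinuousOn f U) (h0 : ∀ z ∈ U, z ∉ K → f z = 0) :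
    IntegrableOn f U := by
  rw [← integrable_indicator_iff hU.measurableSet]
  exact (continuous_indicator_of_compact hU hK hKU hf h0).integrable_of_hasCompactSupport
    (hasCompactSupport_indicator hK h0)

theorem wirtingerBar_eq_zero_of_compact {U K : Set ℂ} (hU : IsOpen U) (hK : IsCompact K)
    {f : ℂ → ℂ} (h0 : ∀ z ∈ U, z ∉ K → f z = 0) {z : ℂ} (hzU : z ∈ U) (hz : z ∉ K) :
    wirtingerBar f z = 0 := by
  have : f =ᶠ[𝓝 z] fun _ => 0 := by
    filter_upwards [hU.mem_nhds hzU, hK.isClosed.isOpen_compl.mem_nhds hz] with w h1 h2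
      using h0 w h1 h2
  rw [wirtingerBar_congr this, wirtingerBar_const]

/-! ### Stokes' theorem in the plane -/

theorem integral_fderiv_eq_zero {f : ℂ → ℂ} (hf : ContDiff ℝ 1 f) (hc : HasCompactSupport f)
    (v : ℂ) : ∫ z, fderiv ℝ f z v = 0 := by
  have hcont : Continuous fun z => fderiv ℝ f z v :=
    (hf.continuous_fderiv one_ne_zero).clm_apply continuous_const
  have hcs : HasCompactSupport fun z => fderiv ℝ f z v := by
    refine HasCompactSupport.intro hc fun z hz => ?_
    have : fderiv ℝ f z = 0 := by
      have h0 : f =ᶠ[𝓝 z] fun _ => 0 := by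
        filter_upwards [(isClosed_tsupport f).isOpen_compl.mem_nhds hz] with w hw
          using image_eq_zero_of_notMem_tsupport hw
      rw [h0.fderiv_eq]; simp
    rw [this]; rfl
  have h := integral_mul_fderiv_eq_neg_fderiv_mul_of_integrable (μ := (volume : Measure ℂ))
    (f := fun _ : ℂ => (1 : ℂ)) (g := f) (v := v) (by simp)
    (by simpa using hcont.integrable_of_hasCompactSupport hcs)
    (by simpa using hf.continuous.integrable_of_hasCompactSupport hc)
    (fun _ _ => differentiableAt_const _) (fun x _ => hf.differentiable one_ne_zero x)
  simpa using h

/-- Since `∂̄a = 0`, the integrand is `∂̄(f a)`, a combination of partial derivatives of a compactly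
supported function. -/
theorem integral_wirtingerBar_mul_eq_zero {U K : Set ℂ} (hU : IsOpen U) (hK : IsCompact K)
    (hKU : K ⊆ U) {f a : ℂ → ℂ} (hf : ContDiffOn ℝ 1 f U) (h0 : ∀ z ∈ U, z ∉ K → f z = 0)
    (ha : DifferentiableOn ℂ a U) : ∫ z in U, wirtingerBar f z * a z = 0 := by
  have ha' : ContDiffOn ℝ 1 a U := (ha.contDiffOn hU).restrict_scalars ℝ
  have hg : ContDiffOn ℝ 1 (fun z => f z * a z) U := hf.mul ha'
  have hg0 : ∀ z ∈ U, z ∉ K → f z * a z = 0 := fun z h1 h2 => by rw [h0 z h1 h2, zero_mul]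
  set g := U.indicator fun z => f z * a z with hgdef
  have hgd : ContDiff ℝ 1 g := contDiff_indicator (n := 1) hU hK hKU hg hg0
  have hgc : HasCompactSupport g := hasCompactSupport_indicator hK hg0
  have hgi : ∀ v, Integrable fun z => fderiv ℝ g z v := fun v =>
    ((hgd.continuous_fderiv one_ne_zero).clm_apply
      continuous_const).integrable_of_hasCompactSupport (hgc.fderiv_apply ℝ v)
  have key : ∫ z in U, wirtingerBar f z * a z = ∫ z, wirtingerBar g z := by
    rw [← integral_indicator hU.measurableSet]
    congr 1
    ext z
    by_cases hz : z ∈ U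
    · have hzn := hU.mem_nhds hz
      have e : g =ᶠ[𝓝 z] fun z => f z * a z := by
        filter_upwards [hzn] with w hw using indicator_of_mem hw _
      rw [indicator_of_mem hz, wirtingerBar_congr e,
        wirtingerBar_mul ((hf.contDiffAt hzn).differentiableAt one_ne_zero)
          ((ha'.contDiffAt hzn).differentiableAt one_ne_zero),
        wirtingerBar_eq_zero (ha.differentiableAt hzn), mul_zero, add_zero]
    · rw [indicator_of_notMem hz, wirtingerBar_congr
        (indicator_eventuallyEq_zero hK hg0 fun h => hz (hKU h)), wirtingerBar_const]
  rw [key]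
  unfold wirtingerBar
  rw [integral_div, integral_add (hgi _) ((hgi _).const_mul _), integral_const_mul,
    integral_fderiv_eq_zero hgd hgc, integral_fderiv_eq_zero hgd hgc]
  simp

/-! ### Holomorphic change of variables -/

theorem abs_det_fderiv_holomorphic (c : ℂ) :
    |((ContinuousLinearMap.toSpanSingleton ℂ c : ℂ →L[ℂ] ℂ).restrictScalars ℝ).det|
      = Complex.normSq c := by
  have : LinearMap.det ((((ContinuousLinearMap.toSpanSingleton ℂ c : ℂ →L[ℂ] ℂ).restrictScalars ℝ)
      : ℂ →L[ℝ] ℂ) : ℂ →ₗ[ℝ] ℂ) = Complex.normSq c := by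
    rw [← LinearMap.det_toMatrix Complex.basisOneI, Matrix.det_fin_two]
    simp [LinearMap.toMatrix_apply, Complex.normSq_apply]
  rw [ContinuousLinearMap.det, this, abs_of_nonneg (Complex.normSq_nonneg c)]

theorem hasFDerivWithinAt_real_of_differentiableOn {τ : ℂ → ℂ} {W : Set ℂ} (hW : IsOpen W)
    (hτ : DifferentiableOn ℂ τ W) {z : ℂ} (hz : z ∈ W) :
    HasFDerivWithinAt τ
      ((ContinuousLinearMap.toSpanSingleton ℂ (deriv τ z) : ℂ →L[ℂ] ℂ).restrictScalars ℝ) W z := by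
  have := ((hτ.differentiableAt (hW.mem_nhds hz)).hasDerivAt.hasFDerivAt.restrictScalars ℝ)
  exact this.hasFDerivWithinAt

/-- The hypothesis `hfg` is the transformation law of the coefficient of a `(1, 1)`-form, and
`normSq` of the derivative is the real Jacobian of `τ`. -/
theorem integral_image_holomorphic {τ : ℂ → ℂ} {W : Set ℂ} (hW : IsOpen W)
    (hτ : DifferentiableOn ℂ τ W) (hinj : InjOn τ W) {f g : ℂ → ℂ}
    (hfg : ∀ z ∈ W, f z = Complex.normSq (deriv τ z) * g (τ z)) :
    ∫ z in τ '' W, g z = ∫ z in W, f z := by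
  rw [integral_image_eq_integral_abs_det_fderiv_smul volume hW.measurableSet
    (fun z hz => hasFDerivWithinAt_real_of_differentiableOn hW hτ hz) hinj]
  refine setIntegral_congr_fun hW.measurableSet fun z hz => ?_
  simp only [abs_det_fderiv_holomorphic]
  rw [hfg z hz, Complex.real_smul]

theorem integrableOn_image_holomorphic {τ : ℂ → ℂ} {W : Set ℂ} (hW : IsOpen W)
    (hτ : DifferentiableOn ℂ τ W) (hinj : InjOn τ W) {f g : ℂ → ℂ}
    (hfg : ∀ z ∈ W, f z = Complex.normSq (deriv τ z) * g (τ z)) :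
    IntegrableOn g (τ '' W) ↔ IntegrableOn f W := by
  rw [integrableOn_image_iff_integrableOn_abs_det_fderiv_smul volume hW.measurableSet
    (fun z hz => hasFDerivWithinAt_real_of_differentiableOn hW hτ hz) hinj]
  refine integrableOn_congr_fun (fun z hz => ?_) hW.measurableSet
  simp only [abs_det_fderiv_holomorphic]
  rw [hfg z hz, Complex.real_smul]

/-! ### The residue of a form with a double pole -/

/-- A smooth function of `t` equal to `0` for `t ≤ a` and to `1` for `t ≥ b`. -/
def smoothStep (a b t : ℝ) : ℝ := Real.smoothTransition ((t - a) / (b - a))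

theorem contDiff_smoothStep (a b : ℝ) {n : ℕ∞} : ContDiff ℝ n (smoothStep a b) :=
  Real.smoothTransition.contDiff.comp ((contDiff_id.sub contDiff_const).div_const _)

theorem smoothStep_of_le {a b t : ℝ} (hab : a < b) (h : t ≤ a) : smoothStep a b t = 0 :=
  Real.smoothTransition.zero_of_nonpos
    (div_nonpos_of_nonpos_of_nonneg (by linarith) (by linarith))

theorem smoothStep_of_ge {a b t : ℝ} (hab : a < b) (h : b ≤ t) : smoothStep a b t = 1 :=
  Real.smoothTransition.one_of_one_le ((one_le_div (by linarith)).2 (by linarith))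

theorem monotone_smoothStep {a b : ℝ} (hab : a < b) : Monotone (smoothStep a b) := fun x y h =>
  Real.smoothTransition.monotone (div_le_div_of_nonneg_right (by linarith) (by linarith))

theorem deriv_smoothStep_eq_zero {a b t : ℝ} (hab : a < b) (h : t < a ∨ b < t) :
    deriv (smoothStep a b) t = 0 := by
  rcases h with h | h
  · have : smoothStep a b =ᶠ[𝓝 t] fun _ => 0 := by
      filter_upwards [Iio_mem_nhds h] with x hx using smoothStep_of_le hab (le_of_lt hx)
    rw [this.deriv_eq]; simp
  · have : smoothStep a b =ᶠ[𝓝 t] fun _ => 1 := by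
      filter_upwards [Ioi_mem_nhds h] with x hx using smoothStep_of_ge hab (le_of_lt hx)
    rw [this.deriv_eq]; simp

/-- In polar coordinates the integral is `2π ∫ y ψ'(y²) dy`, where `ψ` is the step, and `y ψ'(y²)`
is the derivative of `ψ(y²) / 2`, which grows from `0` to `1/2`. -/
theorem integral_deriv_smoothStep_norm_sq {a b : ℝ} (ha : 0 < a) (hab : a < b) :
    ∫ z : ℂ, deriv (smoothStep a b) (‖z‖ ^ 2) = Real.pi := by
  have h := integral_fun_norm_addHaar (volume : Measure ℂ)
    (fun y : ℝ => deriv (smoothStep a b) (y ^ 2))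
  rw [h]
  have hd : ∀ x : ℝ, HasDerivAt (fun y => smoothStep a b (y ^ 2) / 2)
      (x ^ (Module.finrank ℝ ℂ - 1) • deriv (smoothStep a b) (x ^ 2)) x := by
    intro x
    have h1 := ((contDiff_smoothStep a b (n := 1)).differentiable one_ne_zero (x ^ 2)).hasDerivAt
    have h2 := (HasDerivAt.comp (h := fun y : ℝ => y ^ 2) x h1 (hasDerivAt_pow 2 x)).div_const 2
    have e : deriv (smoothStep a b) (x ^ 2) * (((2 : ℕ) : ℝ) * x ^ (2 - 1)) / 2
        = x ^ (Module.finrank ℝ ℂ - 1) • deriv (smoothStep a b) (x ^ 2) := by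
      rw [Complex.finrank_real_complex, smul_eq_mul]
      push_cast
      ring
    rw [← e]
    exact h2
  have hlim : Tendsto (fun y : ℝ => smoothStep a b (y ^ 2) / 2) atTop (𝓝 (1 / 2)) := by
    refine tendsto_const_nhds.congr' ?_
    filter_upwards [eventually_ge_atTop (max 1 b)] with y hy
    have h1 : 1 ≤ y := (le_max_left _ _).trans hy
    have h2 : b ≤ y := (le_max_right _ _).trans hy
    rw [smoothStep_of_ge hab (by nlinarith)]
  have hpos : ∀ x ∈ Ioi (0 : ℝ),
      0 ≤ x ^ (Module.finrank ℝ ℂ - 1) • deriv (smoothStep a b) (x ^ 2) := by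
    intro x hx
    have hx' : (0 : ℝ) < x := hx
    exact smul_nonneg (by positivity) (monotone_smoothStep hab).deriv_nonneg
  rw [integral_Ioi_of_hasDerivAt_of_nonneg' (fun x _ => hd x) hpos hlim,
    smoothStep_of_le hab (by simpa using ha.le)]
  simp [Complex.finrank_real_complex, Measure.real, Complex.volume_ball]
  ring

theorem wirtingerBar_radial {ψ : ℝ → ℝ} (hψ : Differentiable ℝ ψ) (z : ℂ) :
    wirtingerBar (fun ξ => ((ψ (‖ξ‖ ^ 2) : ℝ) : ℂ)) z = deriv ψ (‖z‖ ^ 2) * z := by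
  have h1 : HasFDerivAt (fun ξ : ℂ => ‖ξ‖ ^ 2) (2 • (innerSL ℝ z)) z := by
    simpa using (hasStrictFDerivAt_norm_sq z).hasFDerivAt
  have h2 := (hψ (‖z‖ ^ 2)).hasDerivAt.comp_hasFDerivAt z h1
  have h3 := (Complex.ofRealCLM.hasFDerivAt.comp z h2).fderiv
  have h4 : (fun ξ : ℂ => ((ψ (‖ξ‖ ^ 2) : ℝ) : ℂ)) =
      Complex.ofRealCLM ∘ (ψ ∘ fun ξ : ℂ => ‖ξ‖ ^ 2) := by ext; simp
  rw [wirtingerBar, h4, h3]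
  apply Complex.ext <;> simp [Complex.inner] <;> ring

theorem isOpen_puncturedDisc (r : ℝ) : IsOpen (puncturedDisc r) :=
  isOpen_ball.sdiff isClosed_singleton

theorem mem_puncturedDisc {r : ℝ} {z : ℂ} : z ∈ puncturedDisc r ↔ ‖z‖ < r ∧ z ≠ 0 := by
  simp [puncturedDisc]

/-- The closed annulus `ε ≤ |z| ≤ s`. -/
def closedAnnulus (ε s : ℝ) : Set ℂ := {z | ε ≤ ‖z‖ ∧ ‖z‖ ≤ s}

theorem isCompact_closedAnnulus (ε s : ℝ) : IsCompact (closedAnnulus ε s) := by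
  refine (isCompact_closedBall (0 : ℂ) s).of_isClosed_subset ?_ fun _ hz => by simpa using hz.2
  exact (isClosed_le continuous_const continuous_norm).inter
    (isClosed_le continuous_norm continuous_const)

theorem closedAnnulus_subset {ε s r : ℝ} (hε : 0 < ε) (hs : s < r) :
    closedAnnulus ε s ⊆ puncturedDisc r := fun _ hz =>
  mem_puncturedDisc.2 ⟨hz.2.trans_lt hs, norm_pos_iff.1 (hε.trans_le hz.1)⟩

theorem notMem_closedAnnulus {ε s : ℝ} {z : ℂ} (hz : z ∉ closedAnnulus ε s) :
    ‖z‖ < ε ∨ s < ‖z‖ := by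
  by_contra! h
  exact hz h

/-- Second-order Taylor expansion with holomorphic remainder, obtained by dividing twice. After
division by `z²` only the first two terms remain singular. -/
theorem exists_eq_add_sq_mul {r : ℝ} (hr : 0 < r) {H : ℂ → ℂ}
    (hH : DifferentiableOn ℂ H (ball 0 r)) :
    ∃ k : ℂ → ℂ, DifferentiableOn ℂ k (ball 0 r) ∧
      ∀ z, H z = H 0 + deriv H 0 * z + z ^ 2 * k z := by
  have h0 : ball (0 : ℂ) r ∈ 𝓝 0 := ball_mem_nhds _ hr
  refine ⟨dslope (dslope H 0) 0, ?_, fun z => ?_⟩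
  · exact (Complex.differentiableOn_dslope h0).2 ((Complex.differentiableOn_dslope h0).2 hH)
  · have h1 := sub_smul_dslope H 0 z
    have h2 := sub_smul_dslope (dslope H 0) 0 z
    simp only [sub_zero, smul_eq_mul, dslope_same] at h1 h2
    linear_combination -h1 - z * h2

/-- Residue formula: the integral of `∂̄η ∧ H dz / z²` over a punctured disc, for a cutoff function
`η` which is `0` near the puncture and `1` near the outer boundary. -/
theorem integral_wirtingerBar_mul_div_sq {ε s r : ℝ} (hε : 0 < ε) (hεs : ε < s) (hs : s < r)
    {H η : ℂ → ℂ} (hH : DifferentiableOn ℂ H (ball 0 r))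
    (hη : ContDiffOn ℝ 1 η (puncturedDisc r))
    (h0 : ∀ z ∈ puncturedDisc r, ‖z‖ < ε → η z = 0)
    (h1 : ∀ z ∈ puncturedDisc r, s < ‖z‖ → η z = 1) :
    ∫ z in puncturedDisc r, wirtingerBar η z * (H z / z ^ 2) = Real.pi * deriv H 0 := by
  have hab : ε ^ 2 < s ^ 2 := by nlinarith
  set ψ := smoothStep (ε ^ 2) (s ^ 2) with hψ
  set η₀ : ℂ → ℂ := fun ξ => ((ψ (‖ξ‖ ^ 2) : ℝ) : ℂ) with hη₀
  have hU := isOpen_puncturedDisc r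
  have hK := isCompact_closedAnnulus ε s
  have hKU := closedAnnulus_subset hε hs
  have hη₀d : ContDiff ℝ 1 η₀ :=
    Complex.ofRealCLM.contDiff.comp ((contDiff_smoothStep _ _ (n := 1)).comp (contDiff_norm_sq ℝ))
  have hψd : Differentiable ℝ ψ := (contDiff_smoothStep _ _ (n := 1)).differentiable one_ne_zero
  have hη₀b : ∀ z, wirtingerBar η₀ z = deriv ψ (‖z‖ ^ 2) * z := wirtingerBar_radial hψd
  have hψ' : Continuous (deriv ψ) := (contDiff_smoothStep _ _ (n := 1)).continuous_deriv le_rfl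
  have hψ0 : ∀ z, z ∉ closedAnnulus ε s → deriv ψ (‖z‖ ^ 2) = 0 := by
    intro z hz
    refine deriv_smoothStep_eq_zero hab ?_
    rcases notMem_closedAnnulus hz with h | h
    · left; exact pow_lt_pow_left₀ h (norm_nonneg _) two_ne_zero
    · right; exact pow_lt_pow_left₀ h (by linarith) two_ne_zero
  have hcH : DifferentiableOn ℂ (fun z => H z / z ^ 2) (puncturedDisc r) :=
    (hH.mono sdiff_subset).div (by fun_prop) fun z hz =>
      pow_ne_zero 2 (mem_puncturedDisc.1 hz).2
  -- comparison with the radial cutoff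
  have hdiff : ∀ z ∈ puncturedDisc r, z ∉ closedAnnulus ε s → η z - η₀ z = 0 := by
    intro z hz hzK
    rcases notMem_closedAnnulus hzK with h | h
    · rw [h0 z hz h, hη₀]
      simp only
      rw [hψ, smoothStep_of_le hab (pow_le_pow_left₀ (norm_nonneg _) h.le 2)]; simp
    · rw [h1 z hz h, hη₀]
      simp only
      rw [hψ, smoothStep_of_ge hab (pow_le_pow_left₀ (by linarith) h.le 2)]; simp
  have hsub : ∀ z ∈ puncturedDisc r, wirtingerBar (fun z => η z - η₀ z) z
      = wirtingerBar η z - wirtingerBar η₀ z := fun z hz =>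
    wirtingerBar_sub ((hη.contDiffAt (hU.mem_nhds hz)).differentiableAt one_ne_zero)
      (hη₀d.differentiable one_ne_zero z)
  -- The two cutoffs differ by a function supported in the closed annulus, where `H / z²` is
  -- holomorphic, so replacing `η` by the radial `η₀` does not change the integral.
  have hz1 := integral_wirtingerBar_mul_eq_zero hU hK hKU (hη.sub hη₀d.contDiffOn) hdiff hcH
  have hcmp : ∫ z in puncturedDisc r, wirtingerBar η z * (H z / z ^ 2)
      = ∫ z in puncturedDisc r, wirtingerBar η₀ z * (H z / z ^ 2) := by
    have hi : IntegrableOn (fun z => wirtingerBar (fun z => η z - η₀ z) z * (H z / z ^ 2))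
        (puncturedDisc r) :=
      integrableOn_of_compact hU hK hKU
        ((ContDiffOn.continuousOn_wirtingerBar hU (hη.sub hη₀d.contDiffOn)).mul hcH.continuousOn)
        fun z hz hzK => by rw [wirtingerBar_eq_zero_of_compact hU hK hdiff hz hzK, zero_mul]
    have hi₀ : IntegrableOn (fun z => wirtingerBar η₀ z * (H z / z ^ 2)) (puncturedDisc r) :=
      integrableOn_of_compact hU hK hKU
        ((ContDiffOn.continuousOn_wirtingerBar hU hη₀d.contDiffOn).mul hcH.continuousOn)
        fun z hz hzK => by rw [hη₀b, hψ0 z hzK]; simp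
    rw [← add_zero (∫ z in puncturedDisc r, wirtingerBar η₀ z * (H z / z ^ 2)), ← hz1,
      ← integral_add hi₀ hi]
    refine setIntegral_congr_fun hU.measurableSet fun z hz => ?_
    simp only [hsub z hz]
    ring
  rw [hcmp]
  obtain ⟨k, hk, hHk⟩ := exists_eq_add_sq_mul (hε.trans (hεs.trans hs)) hH
  have hcψ : ContinuousOn (fun z : ℂ => ((deriv ψ (‖z‖ ^ 2) : ℝ) : ℂ)) (puncturedDisc r) := by
    have : Continuous (fun z : ℂ => ((deriv ψ (‖z‖ ^ 2) : ℝ) : ℂ)) := by fun_prop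
    exact this.continuousOn
  have hi1 : IntegrableOn (fun z : ℂ => H 0 * (deriv ψ (‖z‖ ^ 2) * z⁻¹)) (puncturedDisc r) :=
    integrableOn_of_compact hU hK hKU
      (continuousOn_const.mul (hcψ.mul (continuousOn_id.inv₀
        fun z hz => (mem_puncturedDisc.1 hz).2))) fun z hz hzK => by rw [hψ0 z hzK]; simp
  have hi2 : IntegrableOn (fun z : ℂ => deriv H 0 * ((deriv ψ (‖z‖ ^ 2) : ℝ) : ℂ))
      (puncturedDisc r) :=
    integrableOn_of_compact hU hK hKU (continuousOn_const.mul hcψ)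
      fun z hz hzK => by rw [hψ0 z hzK]; simp
  have hi3 : IntegrableOn (fun z : ℂ => wirtingerBar η₀ z * k z) (puncturedDisc r) :=
    integrableOn_of_compact hU hK hKU
      ((ContDiffOn.continuousOn_wirtingerBar hU hη₀d.contDiffOn).mul
        (hk.mono sdiff_subset).continuousOn)
      fun z hz hzK => by rw [hη₀b, hψ0 z hzK]; simp
  -- Since `∂̄η₀ = ψ'(|z|²) z`, the terms of degree `0` and `1` of `H` contribute `ψ' / z` and `ψ'`,
  -- with constant coefficients.
  have hsplit : ∫ z in puncturedDisc r, wirtingerBar η₀ z * (H z / z ^ 2)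
      = (∫ z in puncturedDisc r, H 0 * (deriv ψ (‖z‖ ^ 2) * z⁻¹))
        + (∫ z in puncturedDisc r, deriv H 0 * ((deriv ψ (‖z‖ ^ 2) : ℝ) : ℂ))
        + ∫ z in puncturedDisc r, wirtingerBar η₀ z * k z := by
    rw [← integral_add hi1 hi2, ← integral_add (f := fun z : ℂ =>
      H 0 * (deriv ψ (‖z‖ ^ 2) * z⁻¹) + deriv H 0 * (deriv ψ (‖z‖ ^ 2) : ℝ)) (hi1.add hi2) hi3]
    refine setIntegral_congr_fun hU.measurableSet fun z hz => ?_
    have hz0 := (mem_puncturedDisc.1 hz).2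
    rw [hHk z, hη₀b]
    field_simp
  have hnot : ∀ z, z ∉ puncturedDisc r → deriv ψ (‖z‖ ^ 2) = 0 := fun z hz =>
    hψ0 z fun h => hz (hKU h)
  -- The integrand is odd under `z ↦ -z`.
  have hT1 : ∫ z in puncturedDisc r, H 0 * (deriv ψ (‖z‖ ^ 2) * z⁻¹) = 0 := by
    rw [setIntegral_eq_integral_of_forall_compl_eq_zero fun z hz => by rw [hnot z hz]; simp]
    have h := integral_neg_eq_self (fun z : ℂ => H 0 * (deriv ψ (‖z‖ ^ 2) * z⁻¹)) volume
    simp only [norm_neg, inv_neg, mul_neg, integral_neg] at h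
    exact CharZero.neg_eq_self_iff.1 h
  have hT2 : ∫ z in puncturedDisc r, deriv H 0 * ((deriv ψ (‖z‖ ^ 2) : ℝ) : ℂ)
      = Real.pi * deriv H 0 := by
    rw [setIntegral_eq_integral_of_forall_compl_eq_zero fun z hz => by rw [hnot z hz]; simp,
      integral_const_mul, integral_complex_ofReal,
      integral_deriv_smoothStep_norm_sq (by positivity) hab, mul_comm]
  -- Here nothing is singular at `0`: `η₀ - 1` is smooth on the full disc and vanishes for `|z| >
  -- s`, so Stokes' theorem applies across the puncture.
  have hT3 : ∫ z in puncturedDisc r, wirtingerBar η₀ z * k z = 0 := by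
    have hz3 := integral_wirtingerBar_mul_eq_zero (isOpen_ball (x := (0 : ℂ)) (ε := r))
      (isCompact_closedBall (0 : ℂ) s) (closedBall_subset_ball hs)
      (f := fun z => η₀ z - 1) (hη₀d.sub contDiff_const).contDiffOn (fun z _ hz => by
        have : s < ‖z‖ := by simpa using hz
        simp only [hη₀]
        rw [hψ, smoothStep_of_ge hab (pow_le_pow_left₀ (by linarith) this.le 2)]; simp) hk
    have e : ∀ z, wirtingerBar (fun z => η₀ z - 1) z = wirtingerBar η₀ z := fun z => by
      rw [wirtingerBar_sub (hη₀d.differentiable one_ne_zero z) (differentiableAt_const _),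
        wirtingerBar_const, sub_zero]
    simp only [e] at hz3
    rw [setIntegral_eq_integral_of_forall_compl_eq_zero
      fun z hz => by rw [hη₀b, hnot z hz]; simp]
    rwa [setIntegral_eq_integral_of_forall_compl_eq_zero fun z hz => by
      rw [hη₀b, hnot z fun h => hz h.1]; simp] at hz3
  rw [hsplit, hT1, hT2, hT3]
  ring

/-! ### The equations of a conformal immersion of constant mean curvature one -/

theorem eucInner_eq (u v : ℂ × ℝ) :
    eucInner u v = u.1.re * v.1.re + u.1.im * v.1.im + u.2 * v.2 := by
  simp [eucInner]

theorem fderiv_eucInner {P Q : ℂ → ℂ × ℝ} {z : ℂ} (hP : DifferentiableAt ℝ P z)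
    (hQ : DifferentiableAt ℝ Q z) (v : ℂ) :
    fderiv ℝ (fun ξ => eucInner (P ξ) (Q ξ)) z v
      = eucInner (fderiv ℝ P z v) (Q z) + eucInner (P z) (fderiv ℝ Q z v) := by
  have c1 : ∀ {R : ℂ → ℂ × ℝ}, DifferentiableAt ℝ R z →
      HasFDerivAt (fun ξ => (R ξ).1.re)
        (Complex.reCLM.comp ((ContinuousLinearMap.fst ℝ ℂ ℝ).comp (fderiv ℝ R z))) z := fun h =>
    Complex.reCLM.hasFDerivAt.comp z
      ((ContinuousLinearMap.fst ℝ ℂ ℝ).hasFDerivAt.comp z h.hasFDerivAt)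
  have c2 : ∀ {R : ℂ → ℂ × ℝ}, DifferentiableAt ℝ R z →
      HasFDerivAt (fun ξ => (R ξ).1.im)
        (Complex.imCLM.comp ((ContinuousLinearMap.fst ℝ ℂ ℝ).comp (fderiv ℝ R z))) z := fun h =>
    Complex.imCLM.hasFDerivAt.comp z
      ((ContinuousLinearMap.fst ℝ ℂ ℝ).hasFDerivAt.comp z h.hasFDerivAt)
  have c3 : ∀ {R : ℂ → ℂ × ℝ}, DifferentiableAt ℝ R z →
      HasFDerivAt (fun ξ => (R ξ).2) ((ContinuousLinearMap.snd ℝ ℂ ℝ).comp (fderiv ℝ R z)) z :=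
    fun h => (ContinuousLinearMap.snd ℝ ℂ ℝ).hasFDerivAt.comp z h.hasFDerivAt
  have h := ((((c1 hP).mul (c1 hQ)).add ((c2 hP).mul (c2 hQ))).add ((c3 hP).mul (c3 hQ))).fderiv
  have e : (fun ξ => eucInner (P ξ) (Q ξ)) = ((fun ξ => (P ξ).1.re) * (fun ξ => (Q ξ).1.re)
      + (fun ξ => (P ξ).1.im) * (fun ξ => (Q ξ).1.im)) + (fun ξ => (P ξ).2) * fun ξ => (Q ξ).2 := by
    ext ξ; simp [eucInner_eq]
  rw [e, h]
  simp [eucInner_eq]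
  ring

/-- Put `c = x × y`. The coefficients below are the coordinates of the identity `|c|² u = (u·x) (y ×
c) + (u·y) (c × x) + (u·c) c`. -/
theorem eq_zero_of_eucInner_eq_zero {x y u : ℂ × ℝ} (hc : eucInner (cross x y) (cross x y) ≠ 0)
    (h1 : eucInner u x = 0) (h2 : eucInner u y = 0) (h3 : eucInner u (cross x y) = 0) : u = 0 := by
  simp only [eucInner_eq, cross] at hc h1 h2 h3
  obtain ⟨⟨x1, x2⟩, x3⟩ := x
  obtain ⟨⟨y1, y2⟩, y3⟩ := y
  obtain ⟨⟨u1, u2⟩, u3⟩ := u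
  simp only at hc h1 h2 h3
  have k1 : u1 = 0 := by
    refine (mul_eq_zero.1 ?_).resolve_left hc
    linear_combination (y2 * (x1 * y2 - x2 * y1) - y3 * (x3 * y1 - x1 * y3)) * h1
      + ((x3 * y1 - x1 * y3) * x3 - (x1 * y2 - x2 * y1) * x2) * h2 + (x2 * y3 - x3 * y2) * h3
  have k2 : u2 = 0 := by
    refine (mul_eq_zero.1 ?_).resolve_left hc
    linear_combination (y3 * (x2 * y3 - x3 * y2) - y1 * (x1 * y2 - x2 * y1)) * h1
      + ((x1 * y2 - x2 * y1) * x1 - (x2 * y3 - x3 * y2) * x3) * h2 + (x3 * y1 - x1 * y3) * h3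
  have k3 : u3 = 0 := by
    refine (mul_eq_zero.1 ?_).resolve_left hc
    linear_combination (y1 * (x3 * y1 - x1 * y3) - y2 * (x2 * y3 - x3 * y2)) * h1
      + ((x2 * y3 - x3 * y2) * x2 - (x3 * y1 - x1 * y3) * x1) * h2 + (x1 * y2 - x2 * y1) * h3
  rw [k1, k2, k3]; rfl

theorem eucInner_cross_self (x y : ℂ × ℝ) :
    eucInner (cross x y) (cross x y)
      = eucInner x x * eucInner y y - eucInner x y ^ 2 := by
  simp only [eucInner_eq, cross]; ring

/-- Second derivatives of a map `ℂ → ℂ × ℝ`. -/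
def secondD (Y : ℂ → ℂ × ℝ) (a b z : ℂ) : ℂ × ℝ := fderiv ℝ (partialD Y b) z a

section LocalGeometry

variable {Y : ℂ → ℂ × ℝ} {U : Set ℂ} {z : ℂ}

theorem differentiableAt_of_contDiffOn (hU : IsOpen U) (hY : ContDiffOn ℝ ∞ Y U) (hz : z ∈ U) :
    DifferentiableAt ℝ Y z :=
  (hY.contDiffAt (hU.mem_nhds hz)).differentiableAt (by simp)

theorem contDiffOn_partialD (hU : IsOpen U) (hY : ContDiffOn ℝ ∞ Y U) (a : ℂ) :
    ContDiffOn ℝ ∞ (partialD Y a) U :=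
  (hY.fderiv_of_isOpen hU (m := ∞) (by simp)).clm_apply contDiffOn_const

theorem secondD_symm (hU : IsOpen U) (hY : ContDiffOn ℝ ∞ Y U) (hz : z ∈ U) (a b : ℂ) :
    secondD Y a b z = secondD Y b a z := by
  have hat := hY.contDiffAt (hU.mem_nhds hz)
  have hd : DifferentiableAt ℝ (fderiv ℝ Y) z :=
    ((hY.fderiv_of_isOpen hU (m := ∞) (by simp)).contDiffAt
      (hU.mem_nhds hz)).differentiableAt (by simp)
  have e : ∀ a b, secondD Y a b z = fderiv ℝ (fderiv ℝ Y) z a b := by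
    intro a b
    unfold secondD
    have : partialD Y b = fun ξ => fderiv ℝ Y ξ b := rfl
    rw [this, fderiv_clm_apply hd (differentiableAt_const _)]
    simp
  rw [e, e]
  exact (hat.isSymmSndFDerivAt (by simpa using ENat.LEInfty.out)) a b

theorem eucInner_add_left (u v c : ℂ × ℝ) : eucInner (u + v) c = eucInner u c + eucInner v c := by
  simp only [eucInner_eq, Prod.fst_add, Prod.snd_add, Complex.add_re, Complex.add_im]; ring

/-- This clears the denominators of `meanCurvature` at a conformal point. There `p`, `q`, `r` are
the covariant derivatives `∇_x Y_x`, `∇_y Y_y`, `∇_x Y_y`, `c` is `Y_x × Y_y`, and the unit normal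
is `(E / w)⁻¹ c`. -/
theorem mean_curvature_one_aux {w E : ℝ} {p q r c : ℂ × ℝ} (hE : E ≠ 0)
    (h : (eucInner p ((E / w)⁻¹ • c) / w ^ 2 * (E / w ^ 2)
      - 2 * (eucInner r ((E / w)⁻¹ • c) / w ^ 2 * (0 / w ^ 2))
      + eucInner q ((E / w)⁻¹ • c) / w ^ 2 * (E / w ^ 2))
      / (2 * (E / w ^ 2 * (E / w ^ 2) - (0 / w ^ 2) ^ 2)) = 1) :
    w * (eucInner p c + eucInner q c) = 2 * E ^ 2 := by
  have e : ∀ u : ℂ × ℝ, eucInner u ((E / w)⁻¹ • c) = w / E * eucInner u c := by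
    intro u
    simp [eucInner_eq, Complex.real_smul]
    ring
  rw [e, e, e] at h
  field_simp at h
  refine mul_left_cancel₀ hE ?_
  linear_combination h

/-- In half-space coordinates, a conformal immersion of mean curvature one satisfies
`w ΔY + 2 E e_w - 2 w_x Y_x - 2 w_y Y_y = 2 Y_x × Y_y`, where `E = |Y_x|²`. -/
theorem conformal_meanCurvature_one_equation (hU : IsOpen U) (hY : ContDiffOn ℝ ∞ Y U)
    (hpos : ∀ z ∈ U, 0 < (Y z).2) (hconf : ∀ z ∈ U, IsConformalImmersionAt Y z)
    (hH : ∀ z ∈ U, meanCurvature Y z = 1) (hz : z ∈ U) :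
    (Y z).2 • (secondD Y 1 1 z + secondD Y Complex.I Complex.I z)
      + ((0 : ℂ), 2 * eucInner (partialD Y 1 z) (partialD Y 1 z))
      - (2 * (partialD Y 1 z).2) • partialD Y 1 z
      - (2 * (partialD Y Complex.I z).2) • partialD Y Complex.I z
      = (2 : ℝ) • cross (partialD Y 1 z) (partialD Y Complex.I z) := by
  have hc1 : ∀ ξ ∈ U, eucInner (partialD Y Complex.I ξ) (partialD Y Complex.I ξ)
      = eucInner (partialD Y 1 ξ) (partialD Y 1 ξ) := by
    intro ξ hξ
    have h := (hconf ξ hξ).2.1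
    have hp := hpos ξ hξ
    simp only [firstFF, hypInner] at h
    exact (div_left_inj' (by positivity)).1 h
  have hc2 : ∀ ξ ∈ U, eucInner (partialD Y 1 ξ) (partialD Y Complex.I ξ) = 0 := by
    intro ξ hξ
    have h := (hconf ξ hξ).2.2
    have hp := hpos ξ hξ
    simp only [firstFF, hypInner] at h
    exact (div_eq_zero_iff.1 h).resolve_right (by positivity)
  have hn := hU.mem_nhds hz
  have hd : ∀ a, DifferentiableAt ℝ (partialD Y a) z := fun a =>
    ((contDiffOn_partialD hU hY a).contDiffAt hn).differentiableAt (by simp)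
  -- Differentiating `|Y_y|² = |Y_x|²` and `Y_x · Y_y = 0` controls the tangential part of the
  -- Laplacian of `Y`.
  have hd1 : ∀ v, 2 * eucInner (secondD Y v Complex.I z) (partialD Y Complex.I z)
      = 2 * eucInner (secondD Y v 1 z) (partialD Y 1 z) := by
    intro v
    have h : (fun ξ => eucInner (partialD Y Complex.I ξ) (partialD Y Complex.I ξ)) =ᶠ[𝓝 z]
      fun ξ => eucInner (partialD Y 1 ξ) (partialD Y 1 ξ) := by
      filter_upwards [hn] with ξ hξ using hc1 ξ hξ
    have h2 := congrArg (fun L : ℂ →L[ℝ] ℝ => L v) h.fderiv_eq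
    rw [fderiv_eucInner (hd _) (hd _), fderiv_eucInner (hd _) (hd _)] at h2
    simp only [secondD, eucInner_eq] at h2 ⊢
    linarith
  have hd2 : ∀ v, eucInner (secondD Y v 1 z) (partialD Y Complex.I z)
      + eucInner (partialD Y 1 z) (secondD Y v Complex.I z) = 0 := by
    intro v
    have h : (fun ξ => eucInner (partialD Y 1 ξ) (partialD Y Complex.I ξ)) =ᶠ[𝓝 z]
      fun ξ => 0 := by
      filter_upwards [hn] with ξ hξ using hc2 ξ hξ
    have h2 := congrArg (fun L : ℂ →L[ℝ] ℝ => L v) h.fderiv_eq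
    rw [fderiv_eucInner (hd _) (hd _)] at h2
    simpa [secondD] using h2
  have hx1 := hd1 1
  have hx2 := hd1 Complex.I
  have hx3 := hd2 1
  have hx4 := hd2 Complex.I
  rw [secondD_symm hU hY hz Complex.I 1] at hx2 hx4
  have hE := hc1 z hz
  have hF := hc2 z hz
  have hw := hpos z hz
  have hEpos : 0 < eucInner (partialD Y 1 z) (partialD Y 1 z) := by
    have h := (hconf z hz).1
    simp only [firstFF, hypInner] at h
    by_contra hcon
    exact absurd h (not_lt.2 (div_nonpos_of_nonpos_of_nonneg (not_lt.1 hcon) (by positivity)))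
  have hcc := eucInner_cross_self (partialD Y 1 z) (partialD Y Complex.I z)
  have hm := hH z hz
  -- By Lagrange's identity and conformality, `Y_x × Y_y` has Euclidean length `E`, hence hyperbolic
  -- length `E / w`.
  have hsq : Real.sqrt (eucInner (cross (partialD Y 1 z) (partialD Y Complex.I z))
      (cross (partialD Y 1 z) (partialD Y Complex.I z)) / (Y z).2 ^ 2)
      = eucInner (partialD Y 1 z) (partialD Y 1 z) / (Y z).2 := by
    rw [hcc, hE, hF, show ∀ e w : ℝ, (e * e - 0 ^ 2) / w ^ 2 = (e / w) ^ 2 from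
      fun e w => by rw [div_pow]; ring]
    exact Real.sqrt_sq (by positivity)
  simp only [meanCurvature, secondFF, unitNormal, firstFF, hypInner] at hm
  rw [hsq, hE, hF] at hm
  set x := partialD Y 1 z with hx
  set y := partialD Y Complex.I z with hy
  have e11 : covD Y 1 1 z = secondD Y 1 1 z + christoffel (Y z) x x := rfl
  have e22 : covD Y Complex.I Complex.I z
    = secondD Y Complex.I Complex.I z + christoffel (Y z) y y := rfl
  rw [e11, e22] at hm
  set A := secondD Y 1 1 z
  set B := secondD Y 1 Complex.I z
  set D := secondD Y Complex.I Complex.I z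
  set w := (Y z).2 with hwdef
  have hcne : eucInner (cross x y) (cross x y) ≠ 0 := by
    rw [hcc, hE, hF]
    simpa using hEpos.ne'
  rw [hE, hF] at hcc
  have hkey := mean_curvature_one_aux hEpos.ne' hm
  clear_value A B D w x y
  rw [← sub_eq_zero]
  -- The equation is tested against the frame `x`, `y`, `x × y`. The tangential components come from
  -- the differentiated conformality relations, the normal one from the mean curvature.
  refine eq_zero_of_eucInner_eq_zero (x := x) (y := y) hcne ?_ ?_ ?_
  · simp only [eucInner_eq] at hx1 hx2 hx3 hx4 hE hF
    simp only [eucInner_eq, cross, Prod.fst_add, Prod.fst_sub, Prod.smul_fst, Prod.snd_add,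
      Prod.snd_sub, Prod.smul_snd, Complex.add_re, Complex.sub_re, Complex.add_im, Complex.sub_im,
      Complex.real_smul, Complex.mul_re, Complex.mul_im, Complex.ofReal_re, Complex.ofReal_im,
      Complex.zero_re, Complex.zero_im, smul_eq_mul]
    linear_combination (-w / 2) * hx1 + w * hx4 - 2 * y.2 * hF
  · simp only [eucInner_eq] at hx1 hx2 hx3 hx4 hE hF
    simp only [eucInner_eq, cross, Prod.fst_add, Prod.fst_sub, Prod.smul_fst, Prod.snd_add,
      Prod.snd_sub, Prod.smul_snd, Complex.add_re, Complex.sub_re, Complex.add_im, Complex.sub_im,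
      Complex.real_smul, Complex.mul_re, Complex.mul_im, Complex.ofReal_re, Complex.ofReal_im,
      Complex.zero_re, Complex.zero_im, smul_eq_mul]
    linear_combination (w / 2) * hx2 + w * hx3 - 2 * x.2 * hF - 2 * y.2 * hE
  · have e : eucInner (w • (A + D) + ((0 : ℂ), 2 * eucInner x x) - (2 * x.2) • x - (2 * y.2) • y
        - (2 : ℝ) • cross x y) (cross x y)
        = w * eucInner (A + christoffel (Y z) x x) (cross x y)
          + w * eucInner (D + christoffel (Y z) y y) (cross x y)
          - 2 * eucInner (cross x y) (cross x y) := by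
      -- `w Γ(v, v) = |v|² e_w - 2 v_w v`: summed over `v = x, y`, this accounts for the lower-order
      -- terms of the equation.
      have h1 : ∀ v : ℂ × ℝ, w * eucInner (christoffel (Y z) v v) (cross x y)
          = eucInner ((0 : ℂ), eucInner v v) (cross x y) - 2 * v.2 * eucInner v (cross x y) := by
        intro v
        simp only [christoffel, eucInner_eq, Prod.fst_sub, Prod.smul_fst, Prod.snd_sub,
          Prod.smul_snd, Complex.sub_re, Complex.sub_im, Complex.real_smul, Complex.mul_re,
          Complex.mul_im, Complex.ofReal_re, Complex.ofReal_im, Complex.zero_re, Complex.zero_im,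
          smul_eq_mul, ← hwdef]
        field_simp
        ring
      rw [eucInner_add_left, eucInner_add_left, mul_add, mul_add, h1, h1, hE]
      simp only [eucInner_eq, cross, Prod.fst_add, Prod.fst_sub, Prod.smul_fst, Prod.snd_add,
        Prod.snd_sub, Prod.smul_snd, Complex.add_re, Complex.sub_re, Complex.add_im,
        Complex.sub_im, Complex.real_smul, Complex.mul_re, Complex.mul_im, Complex.ofReal_re,
        Complex.ofReal_im, Complex.zero_re, Complex.zero_im, smul_eq_mul]
      ring
    rw [e, hcc]
    linear_combination hkey

end LocalGeometry

/-! ### The flux form `(∂N) N⁻¹` -/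

/-- The coordinate `ζ` of a parametrized surface. -/
def horizontal (Y : ℂ → ℂ × ℝ) (z : ℂ) : ℂ := (Y z).1

/-- The coordinate `w` of a parametrized surface, as a complex number. -/
def height (Y : ℂ → ℂ × ℝ) (z : ℂ) : ℂ := ((Y z).2 : ℂ)

/-- The upper right entry of `N_z N⁻¹`. -/
def fluxUpper (Y : ℂ → ℂ × ℝ) (z : ℂ) : ℂ :=
  starRingEnd ℂ (wirtingerBar (horizontal Y) z) / height Y z ^ 2

/-- The upper left entry of `N_z N⁻¹`. -/
def fluxDiag (Y : ℂ → ℂ × ℝ) (z : ℂ) : ℂ :=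
  -(wirtinger (height Y) z / height Y z) - horizontal Y z * fluxUpper Y z

/-- The lower left entry of `N_z N⁻¹`. -/
def fluxLower (Y : ℂ → ℂ × ℝ) (z : ℂ) : ℂ :=
  wirtinger (horizontal Y) z + horizontal Y z ^ 2 * fluxUpper Y z
    + 2 * horizontal Y z * fluxDiag Y z

/-- The coefficient of the flux form: the trace-free matrix `N_z N⁻¹`, where `N` is the surface in
the Hermitian model. -/
def fluxForm (Y : ℂ → ℂ × ℝ) (z : ℂ) : Matrix (Fin 2) (Fin 2) ℂ :=
  !![fluxDiag Y z, fluxUpper Y z; fluxLower Y z, -fluxDiag Y z]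

section LocalGeometry

variable {Y : ℂ → ℂ × ℝ} {U : Set ℂ} {z : ℂ}

theorem fderiv_horizontal (hY : DifferentiableAt ℝ Y z) (v : ℂ) :
    fderiv ℝ (horizontal Y) z v = (fderiv ℝ Y z v).1 := by
  have := ((ContinuousLinearMap.fst ℝ ℂ ℝ).hasFDerivAt.comp z hY.hasFDerivAt).fderiv
  have e : horizontal Y = ContinuousLinearMap.fst ℝ ℂ ℝ ∘ Y := rfl
  rw [e, this]; rfl

theorem fderiv_height (hY : DifferentiableAt ℝ Y z) (v : ℂ) :
    fderiv ℝ (height Y) z v = ((fderiv ℝ Y z v).2 : ℂ) := by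
  have := ((Complex.ofRealCLM.comp (ContinuousLinearMap.snd ℝ ℂ ℝ)).hasFDerivAt.comp z
    hY.hasFDerivAt).fderiv
  have e : height Y = Complex.ofRealCLM.comp (ContinuousLinearMap.snd ℝ ℂ ℝ) ∘ Y := rfl
  rw [e, this]; rfl

theorem contDiffOn_horizontal (hY : ContDiffOn ℝ ∞ Y U) : ContDiffOn ℝ ∞ (horizontal Y) U :=
  contDiff_fst.comp_contDiffOn hY

theorem contDiffOn_height (hY : ContDiffOn ℝ ∞ Y U) : ContDiffOn ℝ ∞ (height Y) U :=
  Complex.ofRealCLM.contDiff.comp_contDiffOn (contDiff_snd.comp_contDiffOn hY)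

theorem ContDiffOn.wirtinger {f : ℂ → ℂ} (hU : IsOpen U) (hf : ContDiffOn ℝ ∞ f U) :
    ContDiffOn ℝ ∞ (wirtinger f) U := by
  have h := hf.fderiv_of_isOpen hU (m := ∞) (by simp)
  exact ((h.clm_apply contDiffOn_const).sub
    (contDiffOn_const.mul (h.clm_apply contDiffOn_const))).div_const 2

theorem ContDiffOn.wirtingerBar {f : ℂ → ℂ} (hU : IsOpen U) (hf : ContDiffOn ℝ ∞ f U) :
    ContDiffOn ℝ ∞ (wirtingerBar f) U := by
  have h := hf.fderiv_of_isOpen hU (m := ∞) (by simp)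
  exact ((h.clm_apply contDiffOn_const).add
    (contDiffOn_const.mul (h.clm_apply contDiffOn_const))).div_const 2

theorem contDiffOn_complex_div {f g : ℂ → ℂ} (hf : ContDiffOn ℝ ∞ f U)
    (hg : ContDiffOn ℝ ∞ g U) (h0 : ∀ z ∈ U, g z ≠ 0) :
    ContDiffOn ℝ ∞ (fun z => f z / g z) U := by
  simp only [div_eq_mul_inv]
  exact hf.mul (hg.inv h0)

theorem height_ne_zero (hpos : 0 < (Y z).2) : height Y z ≠ 0 :=
  Complex.ofReal_ne_zero.2 hpos.ne'

theorem contDiffOn_fluxUpper (hU : IsOpen U) (hY : ContDiffOn ℝ ∞ Y U)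
    (hpos : ∀ z ∈ U, 0 < (Y z).2) : ContDiffOn ℝ ∞ (fluxUpper Y) U :=
  contDiffOn_complex_div (Complex.conjCLE.contDiff.comp_contDiffOn
    (ContDiffOn.wirtingerBar hU (contDiffOn_horizontal hY)))
    ((contDiffOn_height hY).pow 2) fun z hz => pow_ne_zero 2 (height_ne_zero (hpos z hz))

theorem contDiffOn_fluxDiag (hU : IsOpen U) (hY : ContDiffOn ℝ ∞ Y U)
    (hpos : ∀ z ∈ U, 0 < (Y z).2) : ContDiffOn ℝ ∞ (fluxDiag Y) U :=
  (contDiffOn_complex_div (ContDiffOn.wirtinger hU (contDiffOn_height hY)) (contDiffOn_height hY)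
    fun z hz => height_ne_zero (hpos z hz)).neg.sub
    ((contDiffOn_horizontal hY).mul (contDiffOn_fluxUpper hU hY hpos))

theorem contDiffOn_fluxLower (hU : IsOpen U) (hY : ContDiffOn ℝ ∞ Y U)
    (hpos : ∀ z ∈ U, 0 < (Y z).2) : ContDiffOn ℝ ∞ (fluxLower Y) U :=
  ((ContDiffOn.wirtinger hU (contDiffOn_horizontal hY)).add
    (((contDiffOn_horizontal hY).pow 2).mul (contDiffOn_fluxUpper hU hY hpos))).add
    ((contDiffOn_const.mul (contDiffOn_horizontal hY)).mul (contDiffOn_fluxDiag hU hY hpos))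

/-- Both mixed derivatives are a quarter of the Laplacian. The second derivatives enter through an
abstract `D`, so that the coordinates `ζ` and `w` are treated alike. -/
theorem wirtingerBar_wirtinger_eq {f : ℂ → ℂ} {D : ℂ → ℂ → ℂ} (hU : IsOpen U)
    (hf : ContDiffOn ℝ ∞ f U) (hz : z ∈ U)
    (hD : ∀ a b, fderiv ℝ (fun ξ => fderiv ℝ f ξ b) z a = D a b)
    (hsymm : D 1 Complex.I = D Complex.I 1) :
    wirtingerBar (wirtinger f) z = (D 1 1 + D Complex.I Complex.I) / 4 ∧
      wirtinger (wirtingerBar f) z = (D 1 1 + D Complex.I Complex.I) / 4 := by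
  have h := hf.fderiv_of_isOpen hU (m := ∞) (by simp)
  have hd : ∀ b, DifferentiableAt ℝ (fun ξ => fderiv ℝ f ξ b) z := fun b =>
    ((h.clm_apply contDiffOn_const).contDiffAt (hU.mem_nhds hz)).differentiableAt (by simp)
  have e1 : ∀ a, fderiv ℝ (wirtinger f) z a = (D a 1 - Complex.I * D a Complex.I) / 2 := by
    intro a
    have := (((hd 1).hasFDerivAt.sub ((hd Complex.I).hasFDerivAt.const_mul Complex.I)).mul_const
      (2⁻¹ : ℂ)).fderiv
    have e : wirtinger f = fun ξ => ((fun ξ => fderiv ℝ f ξ 1) - fun ξ =>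
        Complex.I * fderiv ℝ f ξ Complex.I) ξ * 2⁻¹ := by
      ext ξ; simp [wirtinger, div_eq_mul_inv]
    rw [e, this]
    simp [hD]; ring
  have e2 : ∀ a, fderiv ℝ (wirtingerBar f) z a = (D a 1 + Complex.I * D a Complex.I) / 2 := by
    intro a
    have := (((hd 1).hasFDerivAt.add ((hd Complex.I).hasFDerivAt.const_mul Complex.I)).mul_const
      (2⁻¹ : ℂ)).fderiv
    have e : wirtingerBar f = fun ξ => ((fun ξ => fderiv ℝ f ξ 1) + fun ξ =>
        Complex.I * fderiv ℝ f ξ Complex.I) ξ * 2⁻¹ := by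
      ext ξ; simp [wirtingerBar, div_eq_mul_inv]
    rw [e, this]
    simp [hD]; ring
  constructor
  · rw [wirtingerBar, e1, e1, hsymm]
    linear_combination (-D Complex.I Complex.I / 4) * Complex.I_mul_I
  · rw [wirtinger, e2, e2, hsymm]
    linear_combination (-D Complex.I Complex.I / 4) * Complex.I_mul_I

/-- The equations `w ζ_{z z̄} = 2 w_z ζ_z̄` and `w w_{z z̄} = |w_z|² - |ζ_z̄|²` of a conformal
immersion of mean curvature one. -/
theorem wirtinger_equations (hU : IsOpen U) (hY : ContDiffOn ℝ ∞ Y U)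
    (hpos : ∀ z ∈ U, 0 < (Y z).2) (hconf : ∀ z ∈ U, IsConformalImmersionAt Y z)
    (hH : ∀ z ∈ U, meanCurvature Y z = 1) (hz : z ∈ U) :
    height Y z * wirtingerBar (wirtinger (horizontal Y)) z
        = 2 * wirtinger (height Y) z * wirtingerBar (horizontal Y) z ∧
      height Y z * wirtinger (wirtingerBar (horizontal Y)) z
        = 2 * wirtinger (height Y) z * wirtingerBar (horizontal Y) z ∧
      height Y z * wirtingerBar (wirtinger (height Y)) z
        = wirtinger (height Y) z * wirtingerBar (height Y) z
          - wirtingerBar (horizontal Y) z * starRingEnd ℂ (wirtingerBar (horizontal Y) z) := by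
  have hn := hU.mem_nhds hz
  have hdY := differentiableAt_of_contDiffOn hU hY hz
  have hdP : ∀ b, DifferentiableAt ℝ (partialD Y b) z := fun b =>
    ((contDiffOn_partialD hU hY b).contDiffAt hn).differentiableAt (by simp)
  have hDh : ∀ a b, fderiv ℝ (fun ξ => fderiv ℝ (horizontal Y) ξ b) z a
      = (secondD Y a b z).1 := by
    intro a b
    have e : (fun ξ => fderiv ℝ (horizontal Y) ξ b) =ᶠ[𝓝 z] horizontal (partialD Y b) := by
      filter_upwards [hn] with ξ hξ
        using fderiv_horizontal (differentiableAt_of_contDiffOn hU hY hξ) b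
    rw [e.fderiv_eq, fderiv_horizontal (hdP b)]; rfl
  have hDw : ∀ a b, fderiv ℝ (fun ξ => fderiv ℝ (height Y) ξ b) z a
      = ((secondD Y a b z).2 : ℂ) := by
    intro a b
    have e : (fun ξ => fderiv ℝ (height Y) ξ b) =ᶠ[𝓝 z] height (partialD Y b) := by
      filter_upwards [hn] with ξ hξ
        using fderiv_height (differentiableAt_of_contDiffOn hU hY hξ) b
    rw [e.fderiv_eq, fderiv_height (hdP b)]; rfl
  obtain ⟨k1, k2⟩ := wirtingerBar_wirtinger_eq (D := fun a b => (secondD Y a b z).1) hU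
    (contDiffOn_horizontal hY) hz hDh (by rw [secondD_symm hU hY hz])
  obtain ⟨k3, -⟩ := wirtingerBar_wirtinger_eq (D := fun a b => ((secondD Y a b z).2 : ℂ)) hU
    (contDiffOn_height hY) hz hDw (by rw [secondD_symm hU hY hz])
  have heq := conformal_meanCurvature_one_equation hU hY hpos hconf hH hz
  have hE : eucInner (partialD Y Complex.I z) (partialD Y Complex.I z)
      = eucInner (partialD Y 1 z) (partialD Y 1 z) := by
    have h := (hconf z hz).2.1
    have hp := hpos z hz
    simp only [firstFF, hypInner] at h
    exact (div_left_inj' (by positivity)).1 h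
  have w1 : wirtinger (height Y) z
      = (((partialD Y 1 z).2 : ℂ) - Complex.I * ((partialD Y Complex.I z).2 : ℂ)) / 2 := by
    rw [wirtinger, fderiv_height hdY, fderiv_height hdY]; rfl
  have w2 : wirtingerBar (height Y) z
      = (((partialD Y 1 z).2 : ℂ) + Complex.I * ((partialD Y Complex.I z).2 : ℂ)) / 2 := by
    rw [wirtingerBar, fderiv_height hdY, fderiv_height hdY]; rfl
  have w3 : wirtingerBar (horizontal Y) z
      = ((partialD Y 1 z).1 + Complex.I * (partialD Y Complex.I z).1) / 2 := by
    rw [wirtingerBar, fderiv_horizontal hdY, fderiv_horizontal hdY]; rfl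
  rw [k1, k2, k3, w1, w2, w3]
  simp only [height]
  generalize secondD Y 1 1 z = A at heq ⊢
  generalize secondD Y Complex.I Complex.I z = D at heq ⊢
  generalize (Y z).2 = w at heq ⊢
  generalize partialD Y 1 z = x at heq hE ⊢
  generalize partialD Y Complex.I z = y at heq hE ⊢
  obtain ⟨⟨x1, x2⟩, x3⟩ := x
  obtain ⟨⟨y1, y2⟩, y3⟩ := y
  obtain ⟨⟨a1, a2⟩, a3⟩ := A
  obtain ⟨⟨d1, d2⟩, d3⟩ := D
  rw [Prod.ext_iff, Complex.ext_iff] at heq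
  obtain ⟨⟨h1, h2⟩, h3⟩ := heq
  simp [eucInner_eq, cross] at h1 h2 h3 hE
  -- The horizontal part of `Y_x × Y_y` is `i (w_x ζ_y - w_y ζ_x)`. It completes `w_x ζ_x + w_y ζ_y`
  -- to the product `(w_x - i w_y)(ζ_x + i ζ_y) = 4 w_z ζ_z̄`; the orientation of the normal decides
  -- which product appears.
  have g1 : (w : ℂ) * (((⟨a1, a2⟩ : ℂ) + ⟨d1, d2⟩) / 4)
      = 2 * (((x3 : ℂ) - Complex.I * y3) / 2) * (((⟨x1, x2⟩ : ℂ) + Complex.I * ⟨y1, y2⟩) / 2) := by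
    apply Complex.ext
    · simp
      linarith
    · simp
      linarith
  refine ⟨g1, g1, ?_⟩
  rw [map_div₀, map_add, map_mul, Complex.conj_I, map_ofNat]
  -- The vertical equation becomes the claim once `2 E` is written as `|Y_x|² + |Y_y|²` and the
  -- Jacobian of `ζ` is absorbed in `|ζ_x + i ζ_y|²`.
  apply Complex.ext
  · simp
    linarith
  · simp
    ring

/-- The flux form of a conformal immersion of mean curvature one is holomorphic. -/
theorem differentiableOn_fluxForm (hU : IsOpen U) (hY : ContDiffOn ℝ ∞ Y U)
    (hpos : ∀ z ∈ U, 0 < (Y z).2) (hconf : ∀ z ∈ U, IsConformalImmersionAt Y z)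
    (hH : ∀ z ∈ U, meanCurvature Y z = 1) (i j : Fin 2) :
    DifferentiableOn ℂ (fun z => fluxForm Y z i j) U := by
  have hd : ∀ {f : ℂ → ℂ}, ContDiffOn ℝ ∞ f U → ∀ z ∈ U, DifferentiableAt ℝ f z :=
    fun h z hz => (h.contDiffAt (hU.mem_nhds hz)).differentiableAt (by simp)
  have dh := hd (contDiffOn_horizontal hY)
  have dw := hd (contDiffOn_height hY)
  have dhz := hd (ContDiffOn.wirtinger hU (contDiffOn_horizontal hY))
  have dhb := hd (ContDiffOn.wirtingerBar hU (contDiffOn_horizontal hY))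
  have dwz := hd (ContDiffOn.wirtinger hU (contDiffOn_height hY))
  have db := hd (contDiffOn_fluxUpper hU hY hpos)
  have da := hd (contDiffOn_fluxDiag hU hY hpos)
  have dc := hd (contDiffOn_fluxLower hU hY hpos)
  have hw : ∀ z ∈ U, height Y z ≠ 0 := fun z hz => height_ne_zero (hpos z hz)
  have hwr : ∀ z ∈ U, wirtingerBar (height Y) z = starRingEnd ℂ (wirtinger (height Y) z) := by
    intro z hz
    rw [← wirtingerBar_conj (dw z hz)]
    exact wirtingerBar_congr (Eventually.of_forall fun ξ => (Complex.conj_ofReal _).symm)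
  have upper : ∀ z ∈ U, wirtingerBar (fluxUpper Y) z = 0 := by
    intro z hz
    obtain ⟨-, h2, -⟩ := wirtinger_equations hU hY hpos hconf hH hz
    -- Clearing denominators before applying `∂̄` leaves only product rules. The conjugate of the
    -- equation for `ζ_{z̄ z}` then gives the cancellation.
    have e : (fun ξ => fluxUpper Y ξ * (height Y ξ * height Y ξ)) =ᶠ[𝓝 z]
        fun ξ => starRingEnd ℂ (wirtingerBar (horizontal Y) ξ) := by
      filter_upwards [hU.mem_nhds hz] with ξ hξ
      have := hw ξ hξ
      rw [fluxUpper]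
      field_simp
    have h := wirtingerBar_congr e
    rw [wirtingerBar_mul (db z hz) ((dw z hz).fun_mul (dw z hz)),
      wirtingerBar_mul (dw z hz) (dw z hz), wirtingerBar_conj (dhb z hz), hwr z hz] at h
    have h3 := congrArg (starRingEnd ℂ) h2
    have hreal : starRingEnd ℂ (height Y z) = height Y z := Complex.conj_ofReal _
    simp only [map_mul, map_ofNat, hreal] at h3
    have h4 := e.self_of_nhds
    simp only at h4
    refine (mul_eq_zero.1 ?_).resolve_right (pow_ne_zero 3 (hw z hz))
    linear_combination height Y z * h + h3 - 2 * starRingEnd ℂ (wirtinger (height Y) z) * h4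
  have diag : ∀ z ∈ U, wirtingerBar (fluxDiag Y) z = 0 := by
    intro z hz
    obtain ⟨-, -, h3⟩ := wirtinger_equations hU hY hpos hconf hH hz
    -- In `∂̄` of this relation the derivative of `fluxUpper` drops out, and the equation for `w_{z
    -- z̄}` cancels the other terms apart from `∂̄ fluxDiag`.
    have e : (fun ξ => (fluxDiag Y ξ + horizontal Y ξ * fluxUpper Y ξ) * height Y ξ
        + wirtinger (height Y) ξ) =ᶠ[𝓝 z] fun _ => 0 := by
      filter_upwards [hU.mem_nhds hz] with ξ hξ
      have := hw ξ hξ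
      rw [fluxDiag]
      field_simp
      ring
    have h := wirtingerBar_congr e
    have d1 := (dh z hz).fun_mul (db z hz)
    have d2 := (da z hz).fun_add d1
    rw [wirtingerBar_const, wirtingerBar_add (d2.fun_mul (dw z hz)) (dwz z hz),
      wirtingerBar_mul d2 (dw z hz), wirtingerBar_add (da z hz) d1,
      wirtingerBar_mul (dh z hz) (db z hz), upper z hz] at h
    have h4 := e.self_of_nhds
    simp only at h4
    have h5 : fluxUpper Y z * height Y z ^ 2 = starRingEnd ℂ (wirtingerBar (horizontal Y) z) := by
      have := hw z hz
      rw [fluxUpper]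
      field_simp
    refine (mul_eq_zero.1 ?_).resolve_right (pow_ne_zero 2 (hw z hz))
    linear_combination height Y z * h - h3 - wirtingerBar (height Y) z * h4
      - wirtingerBar (horizontal Y) z * h5
  have lower : ∀ z ∈ U, wirtingerBar (fluxLower Y) z = 0 := by
    intro z hz
    obtain ⟨h1, -, -⟩ := wirtinger_equations hU hY hpos hconf hH hz
    have e : fluxLower Y =ᶠ[𝓝 z] fun ξ => wirtinger (horizontal Y) ξ
        + (horizontal Y ξ * horizontal Y ξ * fluxUpper Y ξ
          + (horizontal Y ξ + horizontal Y ξ) * fluxDiag Y ξ) :=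
      Eventually.of_forall fun ξ => by simp only [fluxLower]; ring
    have d1 := (dh z hz).fun_mul (dh z hz)
    have d2 := (dh z hz).fun_add (dh z hz)
    have d3 := d1.fun_mul (db z hz)
    have d4 := d2.fun_mul (da z hz)
    rw [wirtingerBar_congr e, wirtingerBar_add (dhz z hz) (d3.fun_add d4), wirtingerBar_add d3 d4,
      wirtingerBar_mul d1 (db z hz), wirtingerBar_mul d2 (da z hz),
      wirtingerBar_mul (dh z hz) (dh z hz), wirtingerBar_add (dh z hz) (dh z hz), upper z hz,
      diag z hz]
    have h4 : fluxDiag Y z * height Y z = - wirtinger (height Y) z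
        - horizontal Y z * fluxUpper Y z * height Y z := by
      have := hw z hz
      rw [fluxDiag]
      field_simp
    -- What is left is `ζ_{z z̄} + 2 ζ_z̄ (ζ fluxUpper + fluxDiag)`, and the bracket equals `-w_z /
    -- w`.
    refine (mul_eq_zero.1 ?_).resolve_right (hw z hz)
    linear_combination h1 + 2 * wirtingerBar (horizontal Y) z * h4
  have fin : ∀ {f : ℂ → ℂ}, (∀ z ∈ U, DifferentiableAt ℝ f z) → (∀ z ∈ U, wirtingerBar f z = 0) →
      DifferentiableOn ℂ f U := fun h1 h2 z hz =>
    (differentiableAt_of_wirtingerBar_eq_zero (h1 z hz) (h2 z hz)).differentiableWithinAt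
  fin_cases i <;> fin_cases j
  · exact fin da diag
  · exact fin db upper
  · exact fin dc lower
  · exact (fin da diag).neg

/-- The flux form transforms as a `(1, 0)`-form under holomorphic changes of parameter. -/
theorem fluxForm_comp {τ : ℂ → ℂ} (hY : DifferentiableAt ℝ Y (τ z))
    (hτ : DifferentiableAt ℂ τ z) :
    fluxForm (Y ∘ τ) z = deriv τ z • fluxForm Y (τ z) := by
  have dh : DifferentiableAt ℝ (horizontal Y) (τ z) :=
    (ContinuousLinearMap.fst ℝ ℂ ℝ).differentiableAt.comp _ hY
  have dw : DifferentiableAt ℝ (height Y) (τ z) :=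
    (Complex.ofRealCLM.comp (ContinuousLinearMap.snd ℝ ℂ ℝ)).differentiableAt.comp _ hY
  have e1 : horizontal (Y ∘ τ) = horizontal Y ∘ τ := rfl
  have e2 : height (Y ∘ τ) = height Y ∘ τ := rfl
  have hb : fluxUpper (Y ∘ τ) z = deriv τ z * fluxUpper Y (τ z) := by
    rw [fluxUpper, fluxUpper, e1, e2, wirtingerBar_comp dh hτ]
    simp; ring
  have ha : fluxDiag (Y ∘ τ) z = deriv τ z * fluxDiag Y (τ z) := by
    rw [fluxDiag, fluxDiag, hb, e1, e2, wirtinger_comp dw hτ]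
    simp; ring
  have hc : fluxLower (Y ∘ τ) z = deriv τ z * fluxLower Y (τ z) := by
    rw [fluxLower, fluxLower, ha, hb, e1, wirtinger_comp dh hτ]
    simp; ring
  ext i j
  fin_cases i <;> fin_cases j <;> simp [fluxForm, ha, hb, hc]

theorem fluxForm_congr {Y' : ℂ → ℂ × ℝ} (h : Y =ᶠ[𝓝 z] Y') : fluxForm Y z = fluxForm Y' z := by
  have e1 : horizontal Y =ᶠ[𝓝 z] horizontal Y' := h.mono fun ξ hξ => by simp [horizontal, hξ]
  have e2 : height Y =ᶠ[𝓝 z] height Y' := h.mono fun ξ hξ => by simp [height, hξ]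
  simp only [fluxForm, fluxLower, fluxDiag, fluxUpper, wirtinger_congr e1, wirtingerBar_congr e1,
    wirtinger_congr e2, e1.self_of_nhds, e2.self_of_nhds]

/-- `N_z = (N_z N⁻¹) N`. -/
theorem wirtinger_toHerm (hY : DifferentiableAt ℝ Y z) (hpos : 0 < (Y z).2) (i j : Fin 2) :
    wirtinger (fun ξ => toHerm (Y ξ) i j) z = (fluxForm Y z * toHerm (Y z)) i j := by
  have dh : DifferentiableAt ℝ (horizontal Y) z :=
    (ContinuousLinearMap.fst ℝ ℂ ℝ).differentiableAt.comp _ hY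
  have dw : DifferentiableAt ℝ (height Y) z :=
    (Complex.ofRealCLM.comp (ContinuousLinearMap.snd ℝ ℂ ℝ)).differentiableAt.comp _ hY
  have dc : DifferentiableAt ℝ (fun ξ => starRingEnd ℂ (horizontal Y ξ)) z :=
    Complex.conjCLE.differentiableAt.comp _ dh
  have hw := height_ne_zero hpos
  have di : DifferentiableAt ℝ (fun ξ => (height Y ξ)⁻¹) z := dw.inv hw
  have hinv : wirtinger (fun ξ => (height Y ξ)⁻¹) z
      = -(wirtinger (height Y) z / height Y z ^ 2) := by
    have e : (fun ξ => height Y ξ * (height Y ξ)⁻¹) =ᶠ[𝓝 z] fun _ => 1 := by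
      filter_upwards [dw.continuousAt.eventually_ne hw] with ξ hξ using mul_inv_cancel₀ hξ
    have h := wirtinger_congr e
    rw [wirtinger_mul dw di, wirtinger_const] at h
    field_simp
    field_simp at h
    linear_combination h
  have hconj := wirtinger_conj dh
  have hN : toHerm (Y z) = !![(height Y z)⁻¹, starRingEnd ℂ (horizontal Y z) * (height Y z)⁻¹;
      horizontal Y z * (height Y z)⁻¹, (horizontal Y z * starRingEnd ℂ (horizontal Y z)
        + height Y z * height Y z) * (height Y z)⁻¹] := by
    simp [toHerm, height, horizontal, Complex.mul_conj, sq]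
  rw [hN]
  fin_cases i <;> fin_cases j
  · have e : (fun ξ => toHerm (Y ξ) 0 0) = fun ξ => (height Y ξ)⁻¹ := rfl
    simp only [Fin.zero_eta, Fin.isValue]
    rw [e, hinv]
    simp [fluxForm, fluxDiag]
    field_simp
    ring
  · have e : (fun ξ => toHerm (Y ξ) 0 1)
      = fun ξ => starRingEnd ℂ (horizontal Y ξ) * (height Y ξ)⁻¹ := rfl
    simp only [Fin.zero_eta, Fin.isValue, Fin.mk_one]
    rw [e, wirtinger_mul dc di, hinv, hconj]
    simp [fluxForm, fluxDiag, fluxUpper]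
    field_simp
    ring
  · have e : (fun ξ => toHerm (Y ξ) 1 0) = fun ξ => horizontal Y ξ * (height Y ξ)⁻¹ := rfl
    simp only [Fin.zero_eta, Fin.isValue, Fin.mk_one]
    rw [e, wirtinger_mul dh di, hinv]
    simp [fluxForm, fluxDiag, fluxUpper, fluxLower]
    field_simp
    ring
  · have e : (fun ξ => toHerm (Y ξ) 1 1) = fun ξ => (horizontal Y ξ
        * starRingEnd ℂ (horizontal Y ξ) + height Y ξ * height Y ξ) * (height Y ξ)⁻¹ := by
      ext ξ
      simp [toHerm, height, horizontal, Complex.mul_conj, sq]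
    simp only [Fin.isValue, Fin.mk_one]
    rw [e, wirtinger_mul ((dh.fun_mul dc).fun_add (dw.fun_mul dw)) di, hinv,
      wirtinger_add (dh.fun_mul dc) (dw.fun_mul dw), wirtinger_mul dh dc, wirtinger_mul dw dw,
      hconj]
    simp [fluxForm, fluxDiag, fluxUpper, fluxLower]
    field_simp
    ring

end LocalGeometry

section Param

variable {M : Type*} [TopologicalSpace M] [ChartedSpace ℂ M]

/-! ### Holomorphic parametrizations of a Riemann surface -/

/-- The real manifold underlying a Riemann surface. -/
theorem isManifold_real [IsManifold 𝓘(ℂ) ω M] : IsManifold 𝓘(ℝ, ℂ) ∞ M := by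
  refine isManifold_of_contDiffOn _ _ _ fun c c' h h' => ?_
  have h1 := HasGroupoid.compatible (G := contDiffGroupoid ω 𝓘(ℂ)) h h'
  rw [contDiffGroupoid, mem_groupoid_of_pregroupoid] at h1
  have h2 := h1.1
  simp only [contDiffPregroupoid] at h2
  simpa using ((h2.restrict_scalars ℝ).of_le (le_top : (∞ : ℕ∞ω) ≤ ω))

theorem differentiableOn_transition [IsManifold 𝓘(ℂ) ω M] {c c' : OpenPartialHomeomorph M ℂ}
    (h : c ∈ atlas ℂ M) (h' : c' ∈ atlas ℂ M) :
    DifferentiableOn ℂ (c' ∘ c.symm) (c.target ∩ c.symm ⁻¹' c'.source) := by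
  have h1 := HasGroupoid.compatible (G := contDiffGroupoid ω 𝓘(ℂ)) h h'
  rw [contDiffGroupoid, mem_groupoid_of_pregroupoid] at h1
  have h2 := h1.1
  simp [contDiffPregroupoid] at h2
  exact h2.differentiableOn (by simp)

/-- `φ` is an injective holomorphic parametrization of a part of `M` by the open set `U`. -/
structure IsHolomorphicParam (φ : ℂ → M) (U : Set ℂ) : Prop where
  isOpen : IsOpen U
  injOn : InjOn φ U
  continuousOn : ContinuousOn φ U
  holomorphic : ∀ c ∈ atlas ℂ M, DifferentiableOn ℂ (c ∘ φ) (U ∩ φ ⁻¹' c.source)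

theorem isHolomorphicParam_symm [IsManifold 𝓘(ℂ) ω M] {c : OpenPartialHomeomorph M ℂ}
    (h : c ∈ atlas ℂ M) : IsHolomorphicParam c.symm c.target where
  isOpen := c.open_target
  injOn := c.symm.injOn
  continuousOn := c.continuousOn_symm
  holomorphic _ h' := differentiableOn_transition h h'

theorem IsEndParam.isHolomorphicParam [IsManifold 𝓘(ℂ) ω M] {e : Filter M} {φ : ℂ → M} {r : ℝ}
    (h : IsEndParam e φ r) : IsHolomorphicParam φ (puncturedDisc r) where
  isOpen := isOpen_puncturedDisc r
  injOn := h.injOn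
  continuousOn := h.holomorphic.continuousOn
  holomorphic c hc := by
    have : IsManifold 𝓘(ℂ) 1 M := IsManifold.of_le (n := ω) le_top
    have h1 := (mdifferentiableOn_atlas (I := 𝓘(ℂ)) hc).comp
      (h.holomorphic.mono (inter_subset_left (t := φ ⁻¹' c.source))) fun z hz => hz.2
    exact mdifferentiableOn_iff_differentiableOn.1 h1

theorem contDiffOn_comp_symm [IsManifold 𝓘(ℂ) ω M] {F : Type*} [NormedAddCommGroup F]
    [NormedSpace ℝ F] {u : M → F} (hu : ContMDiff 𝓘(ℝ, ℂ) 𝓘(ℝ, F) ∞ u)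
    {c : OpenPartialHomeomorph M ℂ} (hc : c ∈ atlas ℂ M) :
    ContDiffOn ℝ ∞ (u ∘ c.symm) c.target := by
  have := isManifold_real (M := M)
  have h1 : ContMDiffOn 𝓘(ℝ, ℂ) 𝓘(ℝ, ℂ) ∞ c.symm c.target :=
    contMDiffOn_symm_of_mem_maximalAtlas (IsManifold.subset_maximalAtlas hc)
  exact contMDiffOn_iff_contDiffOn.1 (hu.comp_contMDiffOn h1)

section IsHolomorphicParam

variable {φ : ℂ → M} {U : Set ℂ} (hφ : IsHolomorphicParam φ U)
  {c : OpenPartialHomeomorph M ℂ}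

include hφ

theorem IsHolomorphicParam.isOpen_inter (c : OpenPartialHomeomorph M ℂ) :
    IsOpen (U ∩ φ ⁻¹' c.source) :=
  hφ.continuousOn.isOpen_inter_preimage hφ.isOpen c.open_source

theorem IsHolomorphicParam.differentiableAt (hc : c ∈ atlas ℂ M) {z : ℂ} (hz : z ∈ U)
    (hzc : φ z ∈ c.source) : DifferentiableAt ℂ (c ∘ φ) z :=
  (hφ.holomorphic c hc).differentiableAt ((hφ.isOpen_inter c).mem_nhds ⟨hz, hzc⟩)

theorem IsHolomorphicParam.comp_eventuallyEq {F : Type*} (u : M → F) {z : ℂ} (hz : z ∈ U)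
    (hzc : φ z ∈ c.source) : u ∘ φ =ᶠ[𝓝 z] (u ∘ c.symm) ∘ (c ∘ φ) := by
  filter_upwards [(hφ.isOpen_inter c).mem_nhds ⟨hz, hzc⟩] with ξ hξ
  simp [c.left_inv hξ.2]

theorem IsHolomorphicParam.injOn_comp : InjOn (c ∘ φ) (U ∩ φ ⁻¹' c.source) :=
  fun _ hx _ hy h => hφ.injOn hx.1 hy.1 (c.injOn hx.2 hy.2 h)

theorem IsHolomorphicParam.contDiffOn_comp [IsManifold 𝓘(ℂ) ω M] {F : Type*}
    [NormedAddCommGroup F] [NormedSpace ℝ F] {u : M → F}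
    (hu : ContMDiff 𝓘(ℝ, ℂ) 𝓘(ℝ, F) ∞ u) : ContDiffOn ℝ ∞ (u ∘ φ) U := by
  intro z hz
  have hc := chart_mem_atlas ℂ (φ z)
  have hzc := mem_chart_source ℂ (φ z)
  have hW := hφ.isOpen_inter (chartAt ℂ (φ z))
  have h1 : ContDiffAt ℝ ∞ (chartAt ℂ (φ z) ∘ φ) z :=
    (((hφ.holomorphic _ hc).contDiffOn hW (n := ∞)).contDiffAt
      (hW.mem_nhds ⟨hz, hzc⟩)).restrict_scalars ℝ
  have h2 : ContDiffAt ℝ ∞ (u ∘ (chartAt ℂ (φ z)).symm) (chartAt ℂ (φ z) (φ z)) :=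
    (contDiffOn_comp_symm hu hc).contDiffAt
      ((chartAt ℂ (φ z)).open_target.mem_nhds ((chartAt ℂ (φ z)).map_source hzc))
  exact ((h2.comp z h1).congr_of_eventuallyEq
    (hφ.comp_eventuallyEq u hz hzc)).contDiffWithinAt

end IsHolomorphicParam

/-! ### Holomorphic forms and integration -/

variable (M) in
/-- A holomorphic `1`-form on the Riemann surface `M`, given by its coefficients in the charts. -/
structure HolomorphicForm where
  /-- The coefficient in a chart. -/
  coeff : OpenPartialHomeomorph M ℂ → ℂ → ℂ
  differentiableOn : ∀ c ∈ atlas ℂ M, DifferentiableOn ℂ (coeff c) c.target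
  compat : ∀ c ∈ atlas ℂ M, ∀ c' ∈ atlas ℂ M, ∀ z ∈ c.target, c.symm z ∈ c'.source →
    coeff c z = deriv (c' ∘ c.symm) z * coeff c' (c' (c.symm z))

/-- `a` is the coefficient of the form `α` in the parametrization `φ`. -/
def HolomorphicForm.IsCoeff (α : HolomorphicForm M) (φ : ℂ → M) (U : Set ℂ) (a : ℂ → ℂ) : Prop :=
  ∀ c ∈ atlas ℂ M, ∀ z ∈ U, φ z ∈ c.source → a z = deriv (c ∘ φ) z * α.coeff c (c (φ z))

theorem HolomorphicForm.isCoeff_symm (α : HolomorphicForm M) {c : OpenPartialHomeomorph M ℂ}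
    (hc : c ∈ atlas ℂ M) : α.IsCoeff c.symm c.target (α.coeff c) :=
  fun c' hc' z hz hzc => α.compat c hc c' hc' z hz hzc

/-- The coefficient of the `2`-form `θ ∂̄u ∧ α` in the parametrization `φ`, where `a` is the
coefficient of `α`. -/
def formDensity (φ : ℂ → M) (a : ℂ → ℂ) (θ u : M → ℂ) (z : ℂ) : ℂ :=
  θ (φ z) * (wirtingerBar (u ∘ φ) z * a z)

section Vanishing

variable {φ : ℂ → M} {U : Set ℂ} {u : M → ℂ}

theorem wirtingerBar_comp_eq_zero_of_eventually_const (hφ : IsHolomorphicParam φ U) {z : ℂ}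
    (hz : z ∈ U) {k : ℂ} (h : ∀ᶠ p in 𝓝 (φ z), u p = k) : wirtingerBar (u ∘ φ) z = 0 := by
  have h1 := (hφ.continuousOn.continuousAt (hφ.isOpen.mem_nhds hz)).eventually h
  have h2 : u ∘ φ =ᶠ[𝓝 z] fun _ => k := h1
  rw [wirtingerBar_congr h2, wirtingerBar_const]

theorem formDensity_eq_zero_of_eventually_const (hφ : IsHolomorphicParam φ U) {z : ℂ}
    (hz : z ∈ U) {k : ℂ} (h : ∀ᶠ p in 𝓝 (φ z), u p = k) (a : ℂ → ℂ) (θ : M → ℂ) :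
    formDensity φ a θ u z = 0 := by
  rw [formDensity, wirtingerBar_comp_eq_zero_of_eventually_const hφ hz h, zero_mul, mul_zero]

theorem formDensity_eq_zero_of_left {M : Type*} {φ : ℂ → M} {u θ : M → ℂ} {z : ℂ}
    (h : θ (φ z) = 0) (a : ℂ → ℂ) : formDensity φ a θ u z = 0 := by
  rw [formDensity, h, zero_mul]

theorem eventually_eq_zero_of_notMem_tsupport {M : Type*} [TopologicalSpace M] {u : M → ℂ}
    {p : M} (h : p ∉ tsupport u) :
    ∀ᶠ q in 𝓝 p, u q = 0 := by
  filter_upwards [(isClosed_tsupport u).isOpen_compl.mem_nhds h] with q hq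
    using image_eq_zero_of_notMem_tsupport hq

end Vanishing

/-! ### The form `θ ∂̄u ∧ α` under changes of parametrization -/

section Density

variable [IsManifold 𝓘(ℂ) ω M] {α : HolomorphicForm M} {φ : ℂ → M} {U : Set ℂ} {a : ℂ → ℂ}
  {c : OpenPartialHomeomorph M ℂ} {u : M → ℂ}

/-- `∂̄u` contributes the conjugate of the derivative of the transition map and `α` the derivative
itself; their product is the Jacobian. -/
theorem formDensity_change (hφ : IsHolomorphicParam φ U) (ha : α.IsCoeff φ U a)
    (hc : c ∈ atlas ℂ M) (hu : ContMDiff 𝓘(ℝ, ℂ) 𝓘(ℝ, ℂ) ∞ u) (θ : M → ℂ) :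
    ∀ z ∈ U ∩ φ ⁻¹' c.source, formDensity φ a θ u z
      = Complex.normSq (deriv (c ∘ φ) z) *
        formDensity c.symm (α.coeff c) θ u ((c ∘ φ) z) := by
  rintro z ⟨hz, hzc⟩
  have ht : (c ∘ φ) z ∈ c.target := c.map_source hzc
  have hud : DifferentiableAt ℝ (u ∘ c.symm) ((c ∘ φ) z) :=
    ((contDiffOn_comp_symm hu hc).contDiffAt (c.open_target.mem_nhds ht)).differentiableAt
      (by simp)
  rw [formDensity, formDensity, wirtingerBar_congr (hφ.comp_eventuallyEq u hz hzc),
    wirtingerBar_comp hud (hφ.differentiableAt hc hz hzc), ha c hc z hz hzc,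
    Complex.normSq_eq_conj_mul_self]
  simp only [Function.comp_apply, c.left_inv hzc]
  ring

theorem integral_formDensity_change (hφ : IsHolomorphicParam φ U) (ha : α.IsCoeff φ U a)
    (hc : c ∈ atlas ℂ M) (hu : ContMDiff 𝓘(ℝ, ℂ) 𝓘(ℝ, ℂ) ∞ u) (θ : M → ℂ) :
    ∫ z in (c ∘ φ) '' (U ∩ φ ⁻¹' c.source), formDensity c.symm (α.coeff c) θ u z
      = ∫ z in U ∩ φ ⁻¹' c.source, formDensity φ a θ u z :=
  integral_image_holomorphic (hφ.isOpen_inter c) (hφ.holomorphic c hc) hφ.injOn_comp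
    (formDensity_change hφ ha hc hu θ)

theorem integrableOn_formDensity_change (hφ : IsHolomorphicParam φ U) (ha : α.IsCoeff φ U a)
    (hc : c ∈ atlas ℂ M) (hu : ContMDiff 𝓘(ℝ, ℂ) 𝓘(ℝ, ℂ) ∞ u) (θ : M → ℂ) :
    IntegrableOn (formDensity c.symm (α.coeff c) θ u) ((c ∘ φ) '' (U ∩ φ ⁻¹' c.source)) ↔
      IntegrableOn (formDensity φ a θ u) (U ∩ φ ⁻¹' c.source) :=
  integrableOn_image_holomorphic (hφ.isOpen_inter c) (hφ.holomorphic c hc) hφ.injOn_comp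
    (formDensity_change hφ ha hc hu θ)

theorem integrableOn_formDensity (α : HolomorphicForm M) (hc : c ∈ atlas ℂ M)
    (hu : ContMDiff 𝓘(ℝ, ℂ) 𝓘(ℝ, ℂ) ∞ u) {θ : M → ℂ} (hθ : Continuous θ) {K : Set M}
    (hK : IsCompact K) (hKc : K ⊆ c.source)
    (h0 : ∀ p ∈ c.source, p ∉ K → θ p = 0 ∨ ∀ᶠ q in 𝓝 p, u q = 0) :
    IntegrableOn (formDensity c.symm (α.coeff c) θ u) c.target := by
  have hφ := isHolomorphicParam_symm (M := M) hc
  have hcont : ContinuousOn (formDensity c.symm (α.coeff c) θ u) c.target :=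
    (hθ.comp_continuousOn hφ.continuousOn).mul
      ((ContDiffOn.wirtingerBar c.open_target (contDiffOn_comp_symm hu hc)).continuousOn.mul
        (α.differentiableOn c hc).continuousOn)
  refine integrableOn_of_compact c.open_target (hK.image_of_continuousOn (c.continuousOn.mono hKc))
    ?_ hcont fun z hz hzK => ?_
  · rintro _ ⟨p, hp, rfl⟩
    exact c.map_source (hKc hp)
  · have hp : c.symm z ∉ K := fun h => hzK ⟨_, h, c.right_inv hz⟩
    rcases h0 _ (c.map_target hz) hp with h | h
    · exact formDensity_eq_zero_of_left h _
    · exact formDensity_eq_zero_of_eventually_const hφ hz h _ _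

theorem integral_formDensity_one_eq_zero (α : HolomorphicForm M) (hc : c ∈ atlas ℂ M)
    (hu : ContMDiff 𝓘(ℝ, ℂ) 𝓘(ℝ, ℂ) ∞ u) {K : Set M} (hK : IsCompact K) (hKc : K ⊆ c.source)
    (h0 : ∀ p ∈ c.source, p ∉ K → u p = 0) :
    ∫ z in c.target, formDensity c.symm (α.coeff c) (fun _ => 1) u z = 0 := by
  have h := integral_wirtingerBar_mul_eq_zero c.open_target
    (hK.image_of_continuousOn (c.continuousOn.mono hKc))
    (by rintro _ ⟨p, hp, rfl⟩; exact c.map_source (hKc hp))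
    (f := u ∘ c.symm) ((contDiffOn_comp_symm hu hc).of_le (by simp)) (fun z hz hzK =>
      h0 _ (c.map_target hz) fun h => hzK ⟨_, h, c.right_inv hz⟩) (α.differentiableOn c hc)
  simpa [formDensity] using h

/-- Independence of the chart of the integral of `θ ∂̄u ∧ α`, when `θ` vanishes off the second chart
and `u` off the first one. -/
theorem integral_formDensity_eq (α : HolomorphicForm M) {c c' : OpenPartialHomeomorph M ℂ}
    (hc : c ∈ atlas ℂ M) (hc' : c' ∈ atlas ℂ M)
    (hu : ContMDiff 𝓘(ℝ, ℂ) 𝓘(ℝ, ℂ) ∞ u) (θ : M → ℂ) (hθ : ∀ p ∉ c'.source, θ p = 0)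
    (hus : tsupport u ⊆ c.source) :
    ∫ z in c.target, formDensity c.symm (α.coeff c) θ u z
      = ∫ z in c'.target, formDensity c'.symm (α.coeff c') θ u z := by
  have hφ := isHolomorphicParam_symm (M := M) hc
  have hφ' := isHolomorphicParam_symm (M := M) hc'
  -- Both integrals reduce to the overlap of the charts: outside it the left integrand vanishes
  -- through `θ`, the right one through `u`.
  rw [setIntegral_eq_of_subset_of_forall_sdiff_eq_zero c.open_target.measurableSet
      (inter_subset_left (t := c.symm ⁻¹' c'.source)) fun z hz => ?_,
    ← integral_formDensity_change hφ (α.isCoeff_symm hc) hc' hu θ,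
    setIntegral_eq_of_subset_of_forall_sdiff_eq_zero (s := (c' ∘ c.symm) '' (c.target ∩
      c.symm ⁻¹' c'.source)) c'.open_target.measurableSet ?_ fun z hz => ?_]
  · rintro _ ⟨z, hz, rfl⟩
    exact c'.map_source hz.2
  · refine formDensity_eq_zero_of_eventually_const hφ' hz.1
      (eventually_eq_zero_of_notMem_tsupport fun h => hz.2 ?_) _ _
    refine ⟨c (c'.symm z), ⟨c.map_source (hus h), ?_⟩, ?_⟩
    · simp [c.left_inv (hus h), c'.map_target hz.1]
    · simp [c.left_inv (hus h), c'.right_inv hz.1]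
  · exact formDensity_eq_zero_of_left (hθ _ fun h => hz.2 ⟨hz.1, h⟩) _

end Density

end Param

/-! ### Stokes' theorem on the surface, and neighbourhoods of the ends -/

section Residue

variable {M : Type*} [TopologicalSpace M] [T2Space M] [ChartedSpace ℂ M] [IsManifold 𝓘(ℂ) ω M]

theorem wirtingerBar_sum {ι : Type*} (s : Finset ι) {f : ι → ℂ → ℂ} {z : ℂ}
    (hf : ∀ i ∈ s, DifferentiableAt ℝ (f i) z) :
    wirtingerBar (fun ξ => ∑ i ∈ s, f i ξ) z = ∑ i ∈ s, wirtingerBar (f i) z := by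
  simp only [wirtingerBar]
  rw [fderiv_fun_sum hf]
  simp only [FunLike.coe_sum, Finset.sum_apply]
  rw [← Finset.sum_div, Finset.sum_add_distrib, Finset.mul_sum]

/-- Stokes' theorem for a compactly supported smooth function `u`: the integral of `∂̄u ∧ α`
vanishes. The integral is computed with a partition of unity `ρ` on the support of `u`. -/
theorem sum_integral_formDensity_eq_zero (α : HolomorphicForm M) {ι : Type*} [Fintype ι]
    (c : ι → OpenPartialHomeomorph M ℂ) (hc : ∀ i, c i ∈ atlas ℂ M) (ρ : ι → M → ℂ)
    (hρ : ∀ i, ContMDiff 𝓘(ℝ, ℂ) 𝓘(ℝ, ℂ) ∞ (ρ i)) (hρc : ∀ i, tsupport (ρ i) ⊆ (c i).source)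
    {u : M → ℂ} (hu : ContMDiff 𝓘(ℝ, ℂ) 𝓘(ℝ, ℂ) ∞ u) {L : Set M} (hL : IsCompact L)
    (huL : ∀ p ∉ L, u p = 0) (hsum : ∀ p ∈ L, ∑ i, ρ i p = 1) :
    ∑ j, ∫ z in (c j).target, formDensity (c j).symm (α.coeff (c j)) (ρ j) u z = 0 := by
  have hKc : ∀ i, IsCompact (tsupport (ρ i) ∩ L) := fun i => hL.inter_left (isClosed_tsupport _)
  have hKs : ∀ i, tsupport (ρ i) ∩ L ⊆ (c i).source := fun i => inter_subset_left.trans (hρc i)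
  have hρ0 : ∀ i, ∀ p ∉ (c i).source, ρ i p = 0 := fun i p hp =>
    image_eq_zero_of_notMem_tsupport fun h => hp (hρc i h)
  have hLev : ∀ v : M → ℂ, (∀ p ∉ L, v p = 0) → ∀ p ∉ L, ∀ᶠ q in 𝓝 p, v q = 0 := by
    intro v hv p hp
    filter_upwards [hL.isClosed.isOpen_compl.mem_nhds hp] with q hq using hv q hq
  have hm : ∀ i, ContMDiff 𝓘(ℝ, ℂ) 𝓘(ℝ, ℂ) ∞ fun p => ρ i p * u p := fun i => by
    have := (contDiff_mul (𝕜 := ℝ) (𝔸 := ℂ) (n := ∞)).contMDiff.comp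
      ((hρ i).prodMk_space hu)
    exact this
  have hmL : ∀ i, ∀ p ∉ L, ρ i p * u p = 0 := fun i p hp => by rw [huL p hp, mul_zero]
  have hφ := fun i => isHolomorphicParam_symm (M := M) (hc i)
  -- The partition of unity is used twice, to cut `u` into pieces `ρ i * u` and to weight the
  -- integrals. Each piece lives in a single chart, where the planar Stokes theorem applies.
  have hone : ∀ i, ∫ z in (c i).target,
      formDensity (c i).symm (α.coeff (c i)) (fun _ => 1) (fun p => ρ i p * u p) z = 0 := fun i =>
    integral_formDensity_one_eq_zero α (hc i) (hm i) (hKc i) (hKs i) fun p _ hp => by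
      by_cases h : p ∈ L
      · rw [image_eq_zero_of_notMem_tsupport fun h' => hp ⟨h', h⟩, zero_mul]
      · exact hmL i p h
  have hint : ∀ i j, IntegrableOn (formDensity (c i).symm (α.coeff (c i)) (ρ j)
      fun p => ρ i p * u p) (c i).target := fun i j =>
    integrableOn_formDensity α (hc i) (hm i) (hρ j).continuous (hKc i) (hKs i) fun p _ hp => by
      right
      by_cases h : p ∈ L
      · filter_upwards [eventually_eq_zero_of_notMem_tsupport fun h' => hp ⟨h', h⟩] with q hq
        rw [hq, zero_mul]
      · exact hLev _ (hmL i) p h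
  have hint' : ∀ i j, IntegrableOn (formDensity (c j).symm (α.coeff (c j)) (ρ j)
      fun p => ρ i p * u p) (c j).target := fun i j =>
    integrableOn_formDensity α (hc j) (hm i) (hρ j).continuous (hKc j) (hKs j) fun p _ hp => by
      by_cases h : p ∈ L
      · left
        exact image_eq_zero_of_notMem_tsupport fun h' => hp ⟨h', h⟩
      · right
        exact hLev _ (hmL i) p h
  -- For a fixed piece every weighted integral is transported to its own chart `c i`, where the
  -- weights add up to `1`.
  have hrow : ∀ i, ∑ j, ∫ z in (c j).target, formDensity (c j).symm (α.coeff (c j)) (ρ j)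
      (fun p => ρ i p * u p) z = 0 := by
    intro i
    have h1 : ∀ j, ∫ z in (c j).target, formDensity (c j).symm (α.coeff (c j)) (ρ j)
        (fun p => ρ i p * u p) z = ∫ z in (c i).target,
          formDensity (c i).symm (α.coeff (c i)) (ρ j) (fun p => ρ i p * u p) z := fun j =>
      (integral_formDensity_eq α (hc i) (hc j) (hm i) (ρ j) (hρ0 j)
        ((tsupport_mul_subset_left).trans (hρc i))).symm
    simp only [h1]
    rw [← integral_finsetSum _ fun j _ => hint i j, ← hone i]
    refine setIntegral_congr_fun (c i).open_target.measurableSet fun z hz => ?_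
    by_cases h : (c i).symm z ∈ L
    · simp only [formDensity]
      rw [← Finset.sum_mul, hsum _ h]
    · have h0 := hLev _ (hmL i) _ h
      simp only [formDensity_eq_zero_of_eventually_const (hφ i) hz h0, Finset.sum_const_zero]
  -- Summing over the pieces recovers `u`, since `∑ ρ i = 1` on `L` and `u` vanishes elsewhere.
  -- Exchanging the two sums then concludes.
  have hcol : ∀ j, ∫ z in (c j).target, formDensity (c j).symm (α.coeff (c j)) (ρ j) u z
      = ∑ i, ∫ z in (c j).target, formDensity (c j).symm (α.coeff (c j)) (ρ j)
        (fun p => ρ i p * u p) z := by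
    intro j
    rw [← integral_finsetSum _ fun i _ => hint' i j]
    refine setIntegral_congr_fun (c j).open_target.measurableSet fun z hz => ?_
    have hu' : u ∘ (c j).symm = fun ξ => ∑ i, (fun p => ρ i p * u p) ((c j).symm ξ) := by
      ext ξ
      simp only [Function.comp_apply, ← Finset.sum_mul]
      by_cases h : (c j).symm ξ ∈ L
      · rw [hsum _ h, one_mul]
      · rw [huL _ h, mul_zero]
    have hsumd := wirtingerBar_sum Finset.univ
      (f := fun i => (fun p => ρ i p * u p) ∘ (c j).symm) (z := z) fun i _ =>
        ((contDiffOn_comp_symm (hm i) (hc j)).contDiffAt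
          ((c j).open_target.mem_nhds hz)).differentiableAt (by simp)
    simp only [formDensity]
    rw [← Finset.mul_sum, ← Finset.sum_mul, ← hsumd]
    congr 3
  simp only [hcol]
  rw [Finset.sum_comm]
  exact Finset.sum_eq_zero fun i _ => hrow i

theorem isSigmaCompact_puncturedDisc (r : ℝ) : IsSigmaCompact (puncturedDisc r) := by
  have h := isSigmaCompact_iUnion (fun n : ℕ => closedAnnulus (1 / ((n : ℝ) + 1))
    (r - 1 / ((n : ℝ) + 1))) fun n => (isCompact_closedAnnulus _ _).isSigmaCompact
  convert h using 1
  ext z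
  simp only [mem_iUnion, mem_puncturedDisc]
  constructor
  · rintro ⟨h1, h2⟩
    obtain ⟨n, hn⟩ := exists_nat_one_div_lt (lt_min (norm_pos_iff.2 h2) (sub_pos.2 h1))
    exact ⟨n, (hn.trans_le (min_le_left _ _)).le,
      by linarith [(hn.trans_le (min_le_right _ _)).le]⟩
  · rintro ⟨n, h1, h2⟩
    have : 0 < 1 / ((n : ℝ) + 1) := Nat.one_div_pos_of_nat
    exact ⟨by linarith, norm_pos_iff.1 (by linarith)⟩

theorem image_puncturedDisc_mem {M : Type*} [TopologicalSpace M] [ChartedSpace ℂ M] {e : Filter M}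
    {φ : ℂ → M} {r δ : ℝ} (h : IsEndParam e φ r) (hδ : 0 < δ) : φ '' puncturedDisc δ ∈ e := by
  rw [← h.map_eq]
  refine image_mem_map ?_
  exact sdiff_mem_nhdsWithin_compl (ball_mem_nhds _ hδ) _

theorem exists_puncturedDisc_subset {M : Type*} [TopologicalSpace M] [ChartedSpace ℂ M]
    {e : Filter M} {φ : ℂ → M} {r : ℝ} (h : IsEndParam e φ r) {s : Set M} (hs : s ∈ e) :
    ∃ δ > 0, ∀ z ∈ puncturedDisc δ, φ z ∈ s := by
  rw [← h.map_eq, mem_map, mem_nhdsWithin_iff] at hs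
  obtain ⟨δ, hδ, hsub⟩ := hs
  exact ⟨δ, hδ, fun z hz => hsub ⟨hz.1, hz.2⟩⟩

theorem IsEndParam.mono {M : Type*} [TopologicalSpace M] [ChartedSpace ℂ M] {e : Filter M}
    {φ : ℂ → M} {r δ : ℝ} (h : IsEndParam e φ r) (hδ : 0 < δ) (hδr : δ ≤ r) :
    IsEndParam e φ δ := by
  have hsub : puncturedDisc δ ⊆ puncturedDisc r := sdiff_subset_sdiff_left (ball_subset_ball hδr)
  exact ⟨hδ, h.injOn.mono hsub, h.holomorphic.mono hsub, h.map_eq, h.le_cocompact⟩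

end Residue

/-! ### The residue theorem for finitely many annular ends -/

section Residue

variable {M : Type*} [TopologicalSpace M] [T2Space M] [ChartedSpace ℂ M] [IsManifold 𝓘(ℂ) ω M]

/-- Expansions of the flux form at the ends are known only off the branch cut of the principal
powers; integrals do not see this cut, which lies in the real line. -/
theorem slitPlane_ae : ∀ᵐ z : ℂ, z ∈ Complex.slitPlane := by
  have h0 : volume {z : ℂ | z.im = 0} = 0 := by
    have : {z : ℂ | z.im = 0} = (LinearMap.ker Complex.imLm : Submodule ℝ ℂ) := by ext; simp
    rw [this]
    refine Measure.addHaar_submodule _ _ fun htop => ?_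
    have : Complex.I ∈ LinearMap.ker Complex.imLm := by rw [htop]; trivial
    simp at this
  rw [ae_iff]
  refine measure_mono_null (fun z hz => ?_) h0
  by_contra him
  exact hz (Complex.mem_slitPlane_iff.2 (Or.inr him))

/-- A compact core and finitely many images of punctured discs cover `M`. This countability is what
smooth cutoffs and partitions of unity require. -/
theorem sigmaCompactSpace_of_ends {M : Type*} [TopologicalSpace M] [ChartedSpace ℂ M] {ι : Type*} [Finite ι] {e : ι → Filter M} {φ : ι → ℂ → M}
    {r : ι → ℝ} (hφ : ∀ k, IsEndParam (e k) (φ k) (r k)) (hex : cocompact M ≤ ⨆ k, e k) :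
    SigmaCompactSpace M := by
  have hV : (⋃ k, φ k '' puncturedDisc (r k)) ∈ cocompact M := by
    refine hex ?_
    rw [mem_iSup]
    exact fun k => mem_of_superset (image_puncturedDisc_mem (hφ k) (hφ k).radius_pos)
      (subset_iUnion (fun k => φ k '' puncturedDisc (r k)) k)
  obtain ⟨K, hK, hKV⟩ := mem_cocompact.1 hV
  rw [← isSigmaCompact_univ_iff]
  have h1 : IsSigmaCompact (⋃ o : Option ι, o.elim K fun k => φ k '' puncturedDisc (r k)) := by
    refine isSigmaCompact_iUnion _ fun o => ?_
    cases o with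
    | none => exact hK.isSigmaCompact
    | some k =>
      exact (isSigmaCompact_puncturedDisc _).image_of_continuousOn
        (hφ k).holomorphic.continuousOn
  convert h1
  refine (eq_univ_of_forall fun p => ?_).symm
  rw [mem_iUnion]
  by_cases hp : p ∈ K
  · exact ⟨none, hp⟩
  · obtain ⟨k, hk⟩ := mem_iUnion.1 (hKV hp)
    exact ⟨some k, hk⟩

/-- The integral of `∂̄u ∧ α`, for `u` locally constant off the images of finitely many disjoint
parametrizations, is computed in these parametrizations. -/
theorem sum_integral_eq_sum_integral_param (α : HolomorphicForm M) {ι κ : Type*} [Fintype ι]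
    [Fintype κ] (c : ι → OpenPartialHomeomorph M ℂ) (hc : ∀ i, c i ∈ atlas ℂ M) (ρ : ι → M → ℂ)
    (hρ : ∀ i, ContMDiff 𝓘(ℝ, ℂ) 𝓘(ℝ, ℂ) ∞ (ρ i)) (hρc : ∀ i, tsupport (ρ i) ⊆ (c i).source)
    {u : M → ℂ} (hu : ContMDiff 𝓘(ℝ, ℂ) 𝓘(ℝ, ℂ) ∞ u) {L : Set M} (hL : IsCompact L)
    (huL : ∀ p ∉ L, u p = 0) (hsum : ∀ p ∈ L, ∑ i, ρ i p = 1)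
    (φ : κ → ℂ → M) (U : κ → Set ℂ) (a : κ → ℂ → ℂ) (hφ : ∀ k, IsHolomorphicParam (φ k) (U k))
    (ha : ∀ k, α.IsCoeff (φ k) (U k) (a k))
    (hdisj : Pairwise (Function.onFun Disjoint fun k => φ k '' U k))
    (hu1 : ∀ p, (∀ k, p ∉ φ k '' U k) → ∃ b, ∀ᶠ q in 𝓝 p, u q = b) :
    ∑ j, ∫ z in (c j).target, formDensity (c j).symm (α.coeff (c j)) (ρ j) u z
      = ∑ k, ∫ z in U k, wirtingerBar (u ∘ φ k) z * a k z := by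
  have hρ0 : ∀ i, ∀ p ∉ (c i).source, ρ i p = 0 := fun i p hp =>
    image_eq_zero_of_notMem_tsupport fun h => hp (hρc i h)
  have hLev : ∀ p ∉ L, ∀ᶠ q in 𝓝 p, u q = 0 := by
    intro p hp
    filter_upwards [hL.isClosed.isOpen_compl.mem_nhds hp] with q hq using huL q hq
  have hint : ∀ j, IntegrableOn (formDensity (c j).symm (α.coeff (c j)) (ρ j) u) (c j).target :=
    fun j => integrableOn_formDensity α (hc j) hu (hρ j).continuous
      (hL.inter_left (isClosed_tsupport (ρ j))) (inter_subset_left.trans (hρc j)) fun p _ hp => by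
      by_cases h : p ∈ L
      · left
        exact image_eq_zero_of_notMem_tsupport fun h' => hp ⟨h', h⟩
      · exact Or.inr (hLev p h)
  set W : ι → κ → Set ℂ := fun j k => U k ∩ φ k ⁻¹' (c j).source with hW
  have hWo : ∀ j k, IsOpen (W j k) := fun j k => (hφ k).isOpen_inter (c j)
  have himg : ∀ j k, (c j ∘ φ k) '' W j k ⊆ (c j).target := by
    rintro j k _ ⟨z, hz, rfl⟩
    exact (c j).map_source hz.2
  have hmeas : ∀ j k, MeasurableSet ((c j ∘ φ k) '' W j k) := fun j k =>
    (hWo j k).measurableSet.image_of_continuousOn_injOn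
      ((hφ k).holomorphic (c j) (hc j)).continuousOn (hφ k).injOn_comp
  have hdisj' : ∀ j, Pairwise (Function.onFun Disjoint fun k => (c j ∘ φ k) '' W j k) := by
    intro j k l hkl
    refine Set.disjoint_left.2 ?_
    rintro _ ⟨z, hz, rfl⟩ ⟨w, hw, hwz⟩
    have : φ l w = φ k z := (c j).injOn hw.2 hz.2 hwz
    exact Set.disjoint_left.1 (hdisj hkl) ⟨z, hz.1, rfl⟩ ⟨w, hw.1, this⟩
  have hcell : ∀ j k, ∫ z in (c j ∘ φ k) '' W j k,
      formDensity (c j).symm (α.coeff (c j)) (ρ j) u z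
        = ∫ z in U k, formDensity (φ k) (a k) (ρ j) u z := by
    intro j k
    rw [integral_formDensity_change (hφ k) (ha k) (hc j) hu]
    refine (setIntegral_eq_of_subset_of_forall_sdiff_eq_zero (hφ k).isOpen.measurableSet
      inter_subset_left fun z hz => ?_).symm
    exact formDensity_eq_zero_of_left (hρ0 j _ fun h => hz.2 ⟨hz.1, h⟩) _
  have hcellint : ∀ j k, IntegrableOn (formDensity (φ k) (a k) (ρ j) u) (U k) := by
    intro j k
    refine IntegrableOn.of_forall_sdiff_eq_zero ((integrableOn_formDensity_change (hφ k) (ha k)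
      (hc j) hu (ρ j)).1 ((hint j).mono_set (himg j k))) (hφ k).isOpen.measurableSet fun z hz => ?_
    exact formDensity_eq_zero_of_left (hρ0 j _ fun h => hz.2 ⟨hz.1, h⟩) _
  -- Outside the images of the parametrizations `u` is locally constant, so the density vanishes
  -- there; the images are disjoint, so the integral splits.
  have hchart : ∀ j, ∫ z in (c j).target, formDensity (c j).symm (α.coeff (c j)) (ρ j) u z
      = ∑ k, ∫ z in U k, formDensity (φ k) (a k) (ρ j) u z := by
    intro j
    rw [setIntegral_eq_of_subset_of_forall_sdiff_eq_zero (c j).open_target.measurableSet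
      (iUnion_subset (himg j)) fun z hz => ?_, integral_iUnion_fintype (hmeas j) (hdisj' j)
        fun k => (hint j).mono_set (himg j k)]
    · exact Finset.sum_congr rfl fun k _ => hcell j k
    · obtain ⟨b, hb⟩ := hu1 ((c j).symm z) fun k => by
        rintro ⟨w, hw, hwz⟩
        refine hz.2 (mem_iUnion.2 ⟨k, w, ⟨hw, ?_⟩, ?_⟩)
        · rw [mem_preimage, hwz]; exact (c j).map_target hz.1
        · rw [Function.comp_apply, hwz, (c j).right_inv hz.1]
      exact formDensity_eq_zero_of_eventually_const (isHolomorphicParam_symm (hc j)) hz.1 hb _ _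
  simp only [hchart]
  rw [Finset.sum_comm]
  refine Finset.sum_congr rfl fun k _ => ?_
  rw [← integral_finsetSum _ fun j _ => hcellint j k]
  refine setIntegral_congr_fun (hφ k).isOpen.measurableSet fun z hz => ?_
  by_cases h : φ k z ∈ L
  · simp only [formDensity]
    rw [← Finset.sum_mul, hsum _ h, one_mul]
  · have h0 := hLev _ h
    simp only [formDensity_eq_zero_of_eventually_const (hφ k) hz h0, Finset.sum_const_zero,
      wirtingerBar_comp_eq_zero_of_eventually_const (hφ k) hz h0, zero_mul]

/-- Stokes' theorem is applied to a cutoff `χ` equal to `1` near a compact core `K` and to `0` off a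
compact `L`. Seen from an end, `χ` is `0` near the puncture and `1` near the rim, so that end
contributes `π` times its residue. -/
theorem sum_residue_eq_zero_of_disjoint (α : HolomorphicForm M) {κ : Type*} [Fintype κ]
    {e : κ → Filter M} {φ : κ → ℂ → M} {r : κ → ℝ} (hφ : ∀ k, IsEndParam (e k) (φ k) (r k))
    (hex : cocompact M ≤ ⨆ k, e k) {a H : κ → ℂ → ℂ}
    (ha : ∀ k, α.IsCoeff (φ k) (puncturedDisc (r k)) (a k))
    (hH : ∀ k, DifferentiableOn ℂ (H k) (ball 0 (r k)))
    (haH : ∀ k, ∀ z ∈ puncturedDisc (r k) ∩ Complex.slitPlane, a k z = H k z / z ^ 2)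
    (hdisj : Pairwise (Function.onFun Disjoint fun k => φ k '' puncturedDisc (r k))) :
    ∑ k, deriv (H k) 0 = 0 := by
  have := isManifold_real (M := M)
  have := sigmaCompactSpace_of_ends hφ hex
  have : LocallyCompactSpace M := ChartedSpace.locallyCompactSpace ℂ M
  have hr := fun k => (hφ k).radius_pos
  -- The core is chosen to contain the complement of the half-radius discs, so that `χ = 1` already
  -- on the outer half of each end.
  have hV : (⋃ k, φ k '' puncturedDisc (r k / 2)) ∈ cocompact M := by
    refine hex ?_
    rw [mem_iSup]
    exact fun k => mem_of_superset (image_puncturedDisc_mem (hφ k) (half_pos (hr k)))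
      (subset_iUnion (fun k => φ k '' puncturedDisc (r k / 2)) k)
  obtain ⟨K, hK, hKV⟩ := mem_cocompact.1 hV
  obtain ⟨L, hL, hKL⟩ := exists_compact_superset hK
  obtain ⟨χ, hχ1, hχ0, -⟩ := exists_contMDiffMap_one_nhds_of_subset_interior 𝓘(ℝ, ℂ) (n := ⊤)
    hK.isClosed hKL
  obtain ⟨t, -, ht⟩ := hL.elim_nhds_subcover (fun p => (chartAt ℂ p).source)
    fun p _ => chart_source_mem_nhds ℂ p
  obtain ⟨ρ, hρ⟩ := SmoothPartitionOfUnity.exists_isSubordinate 𝓘(ℝ, ℂ) hL.isClosed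
    (fun i : t => (chartAt ℂ (i : M)).source) (fun i => (chartAt ℂ (i : M)).open_source)
    fun p hp => by
      obtain ⟨q, hq, hpq⟩ := mem_iUnion₂.1 (ht hp)
      exact mem_iUnion.2 ⟨⟨q, hq⟩, hpq⟩
  have hcomplex : ∀ f : C^∞⟮𝓘(ℝ, ℂ), M; 𝓘(ℝ), ℝ⟯,
      ContMDiff 𝓘(ℝ, ℂ) 𝓘(ℝ, ℂ) ∞ fun p => ((f p : ℝ) : ℂ) := fun f =>
    Complex.ofRealCLM.contDiff.contMDiff.comp f.contMDiff
  have hρs : ∀ i, tsupport (fun p => ((ρ i p : ℝ) : ℂ)) ⊆ (chartAt ℂ (i : M)).source := by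
    intro i
    refine (closure_mono fun p hp => ?_).trans (hρ i)
    simpa using hp
  have hsum : ∀ p ∈ L, ∑ i, ((ρ i p : ℝ) : ℂ) = 1 := by
    intro p hp
    have := ρ.sum_eq_one hp
    rw [finsum_eq_sum_of_fintype] at this
    exact_mod_cast this
  have hu := hcomplex χ
  have huL : ∀ p ∉ L, ((χ p : ℝ) : ℂ) = 0 := fun p hp => by rw [hχ0 p hp]; rfl
  have hK1 : ∀ p ∈ K, ∀ᶠ q in 𝓝 p, ((χ q : ℝ) : ℂ) = 1 := fun p hp => by
    filter_upwards [eventually_nhdsSet_iff_forall.1 hχ1 p hp] with q hq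
    rw [hq]; rfl
  have hhalf : ∀ k, puncturedDisc (r k / 2) ⊆ puncturedDisc (r k) := fun k =>
    sdiff_subset_sdiff_left (ball_subset_ball (half_le_self (hr k).le))
  have hparam := fun k => (hφ k).isHolomorphicParam
  have hstokes := sum_integral_formDensity_eq_zero α (fun i : t => chartAt ℂ (i : M))
    (fun i => chart_mem_atlas ℂ _) (fun i p => ((ρ i p : ℝ) : ℂ)) (fun i => hcomplex (ρ i)) hρs hu
    hL huL hsum
  rw [sum_integral_eq_sum_integral_param α (fun i : t => chartAt ℂ (i : M))
    (fun i => chart_mem_atlas ℂ _) (fun i p => ((ρ i p : ℝ) : ℂ)) (fun i => hcomplex (ρ i)) hρs hu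
    hL huL hsum φ (fun k => puncturedDisc (r k)) a hparam ha hdisj fun p hp => ⟨1, hK1 p ?_⟩]
    at hstokes
  · have hres : ∀ k, ∫ z in puncturedDisc (r k),
        wirtingerBar ((fun p => ((χ p : ℝ) : ℂ)) ∘ φ k) z * a k z
          = Real.pi * deriv (H k) 0 := by
      intro k
      have hLc : Lᶜ ∈ e k := (hφ k).le_cocompact hL.compl_mem_cocompact
      obtain ⟨δ, hδ, hδL⟩ := exists_puncturedDisc_subset (hφ k) hLc
      -- `δ` is a radius below which the end has left `L`; the bound `r k / 4` ensures that `ε` is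
      -- less than `s = r k / 2`.
      rw [← integral_wirtingerBar_mul_div_sq (ε := min δ (r k / 4)) (s := r k / 2)
        (lt_min hδ (by linarith [hr k])) ((min_le_right _ _).trans_lt (by linarith [hr k]))
        (half_lt_self (hr k)) (hH k) (((hparam k).contDiffOn_comp hu).of_le (by simp)) ?_ ?_]
      · refine setIntegral_congr_ae (isOpen_puncturedDisc _).measurableSet ?_
        filter_upwards [slitPlane_ae] with z hz hzr
        rw [haH k z ⟨hzr, hz⟩]
      · intro z hz hzε
        exact huL _ (hδL z (mem_puncturedDisc.2
          ⟨hzε.trans_le (min_le_left _ _), (mem_puncturedDisc.1 hz).2⟩))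
      · intro z hz hzs
        refine (hK1 _ ?_).self_of_nhds
        by_contra hzK
        obtain ⟨l, w, hw, hwz⟩ := mem_iUnion.1 (hKV hzK)
        by_cases hkl : k = l
        · subst hkl
          have := (hφ k).injOn (hhalf k hw) hz hwz
          rw [this] at hw
          exact absurd (mem_puncturedDisc.1 hw).1 (not_lt.2 hzs.le)
        · exact Set.disjoint_left.1 (hdisj hkl) ⟨z, hz, rfl⟩ ⟨w, hhalf l hw, hwz⟩
    simp only [hres, ← Finset.mul_sum] at hstokes
    exact (mul_eq_zero.1 hstokes).resolve_left (Complex.ofReal_ne_zero.2 Real.pi_ne_zero)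
  · by_contra hpK
    obtain ⟨l, w, hw, hwz⟩ := mem_iUnion.1 (hKV hpK)
    exact hp l ⟨w, hhalf l hw, hwz⟩

/-- The residue theorem: if the complement of neighbourhoods of finitely many annular ends of a
Riemann surface is relatively compact, the residues at these ends of a holomorphic form with at most
double poles add up to zero. -/
theorem sum_residue_eq_zero (α : HolomorphicForm M) {κ : Type*} [Fintype κ]
    {e : κ → Filter M} {φ : κ → ℂ → M} {r : κ → ℝ} (hφ : ∀ k, IsEndParam (e k) (φ k) (r k))
    (he : Pairwise fun k l => Disjoint (e k) (e l))
    (hex : cocompact M ≤ ⨆ k, e k) {a H : κ → ℂ → ℂ}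
    (ha : ∀ k, α.IsCoeff (φ k) (puncturedDisc (r k)) (a k))
    (hH : ∀ k, DifferentiableOn ℂ (H k) (ball 0 (r k)))
    (haH : ∀ k, ∀ z ∈ puncturedDisc (r k) ∩ Complex.slitPlane, a k z = H k z / z ^ 2) :
    ∑ k, deriv (H k) 0 = 0 := by
  -- Disjoint filters have disjoint members; shrinking the radii makes the images disjoint without
  -- changing the derivatives at `0`.
  obtain ⟨s, hs, hsd⟩ := Pairwise.exists_mem_filter_of_disjoint he
  choose δ hδ hδs using fun k => exists_puncturedDisc_subset (hφ k) (hs k)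
  have hle : ∀ k, min (δ k) (r k) ≤ r k := fun k => min_le_right _ _
  have hsub : ∀ k, puncturedDisc (min (δ k) (r k)) ⊆ puncturedDisc (r k) := fun k =>
    sdiff_subset_sdiff_left (ball_subset_ball (hle k))
  refine sum_residue_eq_zero_of_disjoint α (r := fun k => min (δ k) (r k))
    (fun k => (hφ k).mono (lt_min (hδ k) (hφ k).radius_pos) (hle k)) hex
    (fun k c hc z hz => ha k c hc z (hsub k hz))
    (fun k => (hH k).mono (ball_subset_ball (hle k)))
    (fun k z hz => haH k z ⟨hsub k hz.1, hz.2⟩) fun k l hkl => ?_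
  refine (hsd hkl).mono ?_ ?_
  · rintro _ ⟨z, hz, rfl⟩
    exact hδs k z (sdiff_subset_sdiff_left (ball_subset_ball (min_le_left _ _)) hz)
  · rintro _ ⟨z, hz, rfl⟩
    exact hδs l z (sdiff_subset_sdiff_left (ball_subset_ball (min_le_left _ _)) hz)

end Residue

/-! ### The flux form of a Bryant representation -/

/-- `G Gᴴ` is Hermitian of determinant one with nonzero upper left entry, so its first column, which
is what `ofHerm` reads, determines it. -/
theorem toHerm_ofHerm {G : Matrix (Fin 2) (Fin 2) ℂ} (hG : G.det = 1) :
    toHerm (ofHerm (G * Gᴴ)) = G * Gᴴ := by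
  rw [Matrix.det_fin_two] at hG
  set N := G * Gᴴ with hN
  have h00 : N 0 0 = ((Complex.normSq (G 0 0) + Complex.normSq (G 0 1) : ℝ) : ℂ) := by
    simp [hN, Matrix.mul_apply, Complex.mul_conj]
  have h01 : N 0 1 = starRingEnd ℂ (N 1 0) := by
    simp [hN, Matrix.mul_apply]; ring
  have hdet : N 0 0 * N 1 1 - N 0 1 * N 1 0 = 1 := by
    have h2 := congrArg (starRingEnd ℂ) hG
    simp only [map_sub, map_mul, map_one] at h2
    simp only [hN, Matrix.mul_apply, Fin.sum_univ_two, Matrix.conjTranspose_apply,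
      Complex.star_def]
    linear_combination (starRingEnd ℂ (G 0 0) * starRingEnd ℂ (G 1 1)
      - starRingEnd ℂ (G 0 1) * starRingEnd ℂ (G 1 0)) * hG + h2
  set s : ℝ := Complex.normSq (G 0 0) + Complex.normSq (G 0 1) with hs
  have hspos : s ≠ 0 := by
    intro h0
    have h1 := Complex.normSq_nonneg (G 0 0)
    have h2 := Complex.normSq_nonneg (G 0 1)
    have h3 : G 0 0 = 0 := Complex.normSq_eq_zero.1 (by linarith)
    have h4 : G 0 1 = 0 := Complex.normSq_eq_zero.1 (by linarith)
    rw [h3, h4] at hG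
    simp at hG
  have hsC : (s : ℂ) ≠ 0 := Complex.ofReal_ne_zero.2 hspos
  rw [h00, h01] at hdet
  clear_value N
  ext i j
  fin_cases i <;> fin_cases j
  · simp [toHerm, ofHerm, h00]
  · simp [toHerm, ofHerm, h00, h01, hsC]
  · simp [toHerm, ofHerm, h00, hsC]
  · simp only [toHerm, ofHerm, h00, Complex.ofReal_re, Matrix.of_apply, Matrix.cons_val', Fin.mk_one,
      Matrix.cons_val_one, Matrix.cons_val_fin_one, Fin.isValue, Complex.ofReal_add,
      Complex.ofReal_inv, inv_inv, Complex.ofReal_pow, map_div₀, Complex.normSq_ofReal,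
      Complex.ofReal_div, Complex.ofReal_mul]
    rw [← Complex.mul_conj]
    field_simp
    linear_combination -hdet

/-- The Cholesky factor. It puts `P N Pᴴ` in the form `G Gᴴ`, to which `toHerm_ofHerm` applies. -/
theorem exists_toHerm_eq {p : ℂ × ℝ} (hp : 0 < p.2) :
    ∃ Q : Matrix (Fin 2) (Fin 2) ℂ, Q.det = 1 ∧ toHerm p = Q * Qᴴ := by
  set s : ℝ := Real.sqrt p.2 with hs
  have hs2 : s * s = p.2 := Real.mul_self_sqrt hp.le
  have hs0 : (s : ℂ) ≠ 0 := Complex.ofReal_ne_zero.2 (Real.sqrt_pos.2 hp).ne'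
  have hp2 : (p.2 : ℂ) = s * s := by rw [← hs2]; push_cast; ring
  refine ⟨!![(s : ℂ)⁻¹, 0; p.1 * (s : ℂ)⁻¹, s], ?_, ?_⟩
  · simp [Matrix.det_fin_two, hs0]
  · ext i j
    fin_cases i <;> fin_cases j
    · simp [toHerm, Matrix.mul_apply, hp2]
    · simp [toHerm, Matrix.mul_apply, hp2]; ring
    · simp [toHerm, Matrix.mul_apply, hp2]; ring
    · simp [toHerm, Matrix.mul_apply, hp2, ← Complex.mul_conj]
      field_simp

theorem toHerm_reflection (p : ℂ × ℝ) : toHerm (reflection p) = (toHerm p).map (starRingEnd ℂ) := by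
  ext i j
  fin_cases i <;> fin_cases j <;> simp [toHerm, reflection, Complex.normSq_conj]

/-- Undoing the isometry replaces `F` by `P⁻¹ F`, which is again a Bryant representation with the
same Weierstrass data. -/
theorem toHerm_eq_of_directIsometry_eq {P : Matrix.SpecialLinearGroup (Fin 2) ℂ} {p : ℂ × ℝ}
    (hp : 0 < p.2) {F : Matrix (Fin 2) (Fin 2) ℂ} (hF : F.det = 1)
    (h : directIsometry P p = ofHerm (F * Fᴴ)) :
    toHerm p = ((P⁻¹ : Matrix.SpecialLinearGroup (Fin 2) ℂ).1 * F)
      * ((P⁻¹ : Matrix.SpecialLinearGroup (Fin 2) ℂ).1 * F)ᴴ := by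
  obtain ⟨Q, hQ, hpQ⟩ := exists_toHerm_eq hp
  have h1 : P.1 * toHerm p * P.1ᴴ = F * Fᴴ := by
    have e : P.1 * toHerm p * P.1ᴴ = (P.1 * Q) * (P.1 * Q)ᴴ := by
      rw [hpQ, Matrix.conjTranspose_mul]
      simp only [Matrix.mul_assoc]
    rw [e, ← toHerm_ofHerm hF, ← h, directIsometry, e,
      toHerm_ofHerm (by rw [Matrix.det_mul, P.2, hQ, one_mul])]
  have h2 : (P⁻¹ : Matrix.SpecialLinearGroup (Fin 2) ℂ).1 * P.1 = 1 := by
    rw [← Matrix.SpecialLinearGroup.coe_mul, inv_mul_cancel]; rfl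
  have h3 : P.1ᴴ * (P⁻¹ : Matrix.SpecialLinearGroup (Fin 2) ℂ).1ᴴ = 1 := by
    rw [← Matrix.conjTranspose_mul, h2, Matrix.conjTranspose_one]
  rw [Matrix.conjTranspose_mul]
  calc toHerm p = ((P⁻¹ : Matrix.SpecialLinearGroup (Fin 2) ℂ).1 * P.1) * toHerm p
        * (P.1ᴴ * (P⁻¹ : Matrix.SpecialLinearGroup (Fin 2) ℂ).1ᴴ) := by
          rw [h2, h3, one_mul, mul_one]
    _ = (P⁻¹ : Matrix.SpecialLinearGroup (Fin 2) ℂ).1 * (P.1 * toHerm p * P.1ᴴ)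
        * (P⁻¹ : Matrix.SpecialLinearGroup (Fin 2) ℂ).1ᴴ := by
          simp only [Matrix.mul_assoc]
    _ = _ := by rw [h1]; simp only [Matrix.mul_assoc]

/-- If `N = G G*` with `G` holomorphic and `G' = G W`, then `N_z N⁻¹ = G W G⁻¹`. -/
theorem fluxForm_eq_of_toHerm_eq {Y : ℂ → ℂ × ℝ} {z : ℂ} (hY : DifferentiableAt ℝ Y z)
    (hpos : 0 < (Y z).2) {G : ℂ → Matrix (Fin 2) (Fin 2) ℂ} {W : Matrix (Fin 2) (Fin 2) ℂ}
    (hG : ∀ᶠ ξ in 𝓝 z, toHerm (Y ξ) = G ξ * (G ξ)ᴴ) (hdet : (G z).det = 1)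
    (hW : ∀ i j, HasDerivAt (fun ξ => G ξ i j) ((G z * W) i j) z) :
    fluxForm Y z = G z * W * (G z).adjugate := by
  have hGd : ∀ i j, DifferentiableAt ℂ (fun ξ => G ξ i j) z := fun i j =>
    (hW i j).differentiableAt
  have hGr : ∀ i j, DifferentiableAt ℝ (fun ξ => G ξ i j) z := fun i j =>
    (hGd i j).restrictScalars ℝ
  have hGc : ∀ i j, DifferentiableAt ℝ (fun ξ => starRingEnd ℂ (G ξ i j)) z := fun i j =>
    Complex.conjCLE.differentiableAt.comp _ (hGr i j)
  -- `∂/∂z` acts on the holomorphic factor `G` alone, since the entries of `Gᴴ` are antiholomorphic.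
  have key : fluxForm Y z * (G z * (G z)ᴴ) = G z * W * (G z)ᴴ := by
    rw [← hG.self_of_nhds]
    ext i j
    rw [← wirtinger_toHerm hY hpos]
    have e : (fun ξ => toHerm (Y ξ) i j) =ᶠ[𝓝 z] fun ξ =>
        G ξ i 0 * starRingEnd ℂ (G ξ j 0) + G ξ i 1 * starRingEnd ℂ (G ξ j 1) := by
      filter_upwards [hG] with ξ hξ
      rw [hξ]
      simp [Matrix.mul_apply]
    have hw : ∀ k, wirtinger (fun ξ => G ξ i k * starRingEnd ℂ (G ξ j k)) z
        = (G z * W) i k * starRingEnd ℂ (G z j k) := fun k => by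
      rw [wirtinger_mul (hGr i k) (hGc j k), wirtinger_eq_deriv (hGd i k), (hW i k).deriv,
        wirtinger_conj (hGr j k), wirtingerBar_eq_zero (hGd j k), map_zero, mul_zero, add_zero]
    rw [wirtinger_congr e, wirtinger_add ((hGr i 0).fun_mul (hGc j 0))
      ((hGr i 1).fun_mul (hGc j 1)), hw, hw,
      Matrix.mul_apply (M := G z * W) (N := (G z)ᴴ), Fin.sum_univ_two]
    rfl
  have h1 : G z * (G z).adjugate = 1 := by rw [Matrix.mul_adjugate, hdet, one_smul]
  have h2 : (G z)ᴴ * ((G z).adjugate)ᴴ = 1 := by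
    rw [← Matrix.conjTranspose_mul, Matrix.adjugate_mul, hdet, one_smul,
      Matrix.conjTranspose_one]
  calc fluxForm Y z = fluxForm Y z * (G z * ((G z)ᴴ * ((G z).adjugate)ᴴ) * (G z).adjugate) := by
        rw [h2, mul_one, h1, mul_one]
    _ = fluxForm Y z * (G z * (G z)ᴴ) * ((G z).adjugate)ᴴ * (G z).adjugate := by
        simp only [Matrix.mul_assoc]
    _ = G z * W * ((G z)ᴴ * ((G z).adjugate)ᴴ) * (G z).adjugate := by
        rw [key]; simp only [Matrix.mul_assoc]
    _ = _ := by rw [h2, mul_one]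

/-! ### Matrix residues and their behaviour under isometries -/

/-- The coefficient matrix `(g, -g²; 1, -g) ω` of a Bryant representation. -/
def bryantMatrix (g w : ℂ → ℂ) (z : ℂ) : Matrix (Fin 2) (Fin 2) ℂ :=
  w z • !![g z, -(g z) ^ 2; 1, -(g z)]

/-- The matrix `(g, -g²; 1, -g)` is the rank-one product of the column `(g, 1)` and the row `(1,
-g)`, so its conjugate involves only the two functions `a g + b` and `c g + d`. -/
theorem mul_bryantMatrix_mul_adjugate (a b c d : ℂ) (g w : ℂ → ℂ) (z : ℂ) :
    !![a, b; c, d] * bryantMatrix g w z * (!![a, b; c, d]).adjugate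
      = !![w z * ((a * g z + b) * (c * g z + d)), -(w z * (a * g z + b) ^ 2);
          w z * (c * g z + d) ^ 2, -(w z * ((a * g z + b) * (c * g z + d)))] := by
  rw [Matrix.adjugate_fin_two_of, bryantMatrix]
  ext i j
  fin_cases i <;> fin_cases j <;> simp [Matrix.mul_apply, Fin.sum_univ_two] <;> ring

/-- `H / z²` is the coefficient of `dF F⁻¹` on the punctured disc, with `H` holomorphic on the
disc, and `R` is its residue. -/
structure HasFluxResidue (A : ℂ → Matrix (Fin 2) (Fin 2) ℂ) (r : ℝ)
    (H : ℂ → Matrix (Fin 2) (Fin 2) ℂ) (R : Matrix (Fin 2) (Fin 2) ℂ) : Prop where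
  differentiableOn : ∀ i j, DifferentiableOn ℂ (fun z => H z i j) (ball 0 r)
  hasDerivAt : ∀ i j, HasDerivAt (fun z => H z i j) (R i j) 0
  eq : ∀ z ∈ puncturedDisc r ∩ Complex.slitPlane, A z = (z ^ 2)⁻¹ • H z

theorem HasFluxResidue.conj_mul {A H : ℂ → Matrix (Fin 2) (Fin 2) ℂ} {r : ℝ}
    {R : Matrix (Fin 2) (Fin 2) ℂ} (h : HasFluxResidue A r H R) (Q S : Matrix (Fin 2) (Fin 2) ℂ) :
    HasFluxResidue (fun z => Q * A z * S) r (fun z => Q * H z * S) (Q * R * S) where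
  differentiableOn i j := by
    have := h.differentiableOn
    simp only [Matrix.mul_apply, Fin.sum_univ_two]
    fun_prop
  hasDerivAt i j := by
    have := h.hasDerivAt
    simp only [Matrix.mul_apply, Fin.sum_univ_two]
    exact ((((this 0 0).const_mul _).add ((this 1 0).const_mul _)).mul_const _).add
      ((((this 0 1).const_mul _).add ((this 1 1).const_mul _)).mul_const _)
  eq z hz := by
    rw [h.eq z hz]
    simp

theorem conj_mem_puncturedDisc_slitPlane {r : ℝ} {z : ℂ}
    (hz : z ∈ puncturedDisc r ∩ Complex.slitPlane) :
    starRingEnd ℂ z ∈ puncturedDisc r ∩ Complex.slitPlane := by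
  obtain ⟨h1, h2⟩ := hz
  refine ⟨?_, ?_⟩
  · rw [mem_puncturedDisc] at h1 ⊢
    exact ⟨by simpa using h1.1, by simpa using h1.2⟩
  · rw [Complex.mem_slitPlane_iff] at h2 ⊢
    simpa using h2

theorem hasDerivAt_conj_comp_conj {f : ℂ → ℂ} {f' z : ℂ}
    (h : HasDerivAt f f' (starRingEnd ℂ z)) :
    HasDerivAt (fun ξ => starRingEnd ℂ (f (starRingEnd ℂ ξ))) (starRingEnd ℂ f') z := by
  have := h.conj_conj
  simpa [Function.comp_def] using this

theorem HasFluxResidue.map_conj {A H : ℂ → Matrix (Fin 2) (Fin 2) ℂ} {r : ℝ}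
    {R : Matrix (Fin 2) (Fin 2) ℂ} (h : HasFluxResidue A r H R) :
    HasFluxResidue (fun z => (A (starRingEnd ℂ z)).map (starRingEnd ℂ)) r
      (fun z => (H (starRingEnd ℂ z)).map (starRingEnd ℂ)) (R.map (starRingEnd ℂ)) where
  differentiableOn i j z hz := by
    have hz' : starRingEnd ℂ z ∈ ball (0 : ℂ) r := by simpa using hz
    have h1 := ((h.differentiableOn i j).differentiableAt (isOpen_ball.mem_nhds hz')).hasDerivAt
    exact (hasDerivAt_conj_comp_conj h1).differentiableAt.differentiableWithinAt
  hasDerivAt i j := by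
    have := h.hasDerivAt i j
    rw [← map_zero (starRingEnd ℂ)] at this
    exact hasDerivAt_conj_comp_conj this
  eq z hz := by
    rw [h.eq _ (conj_mem_puncturedDisc_slitPlane hz)]
    ext i j
    simp

/-- The flux form of a surface isometric to the end `F F*` has the same type of residue as `F F*`. -/
theorem exists_hasFluxResidue_of_isometric {M : Type*} {X : M → ℂ × ℝ} {φ : ℂ → M} {r : ℝ}
    {F : ℂ → Matrix (Fin 2) (Fin 2) ℂ} {g w : ℂ → ℂ} (hF : IsBryantRepresentation F g w r)
    (hX : ContDiffOn ℝ ∞ (X ∘ φ) (puncturedDisc r)) (hpos : ∀ p, 0 < (X p).2)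
    {P : Matrix.SpecialLinearGroup (Fin 2) ℂ}
    (hP : (∀ z ∈ puncturedDisc r, directIsometry P (X (φ z)) = bryantMap F z) ∨
      (∀ z ∈ puncturedDisc r,
        directIsometry P (reflection (X (φ z))) = bryantMap F (starRingEnd ℂ z)))
    {H : ℂ → Matrix (Fin 2) (Fin 2) ℂ} {R : Matrix (Fin 2) (Fin 2) ℂ}
    (hH : HasFluxResidue (fun z => F z * bryantMatrix g w z * (F z).adjugate) r H R) :
    ∃ H' R', HasFluxResidue (fluxForm (X ∘ φ)) r H' R' ∧ (R'.det = 0 ↔ R.det = 0) := by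
  obtain ⟨hdet, hder⟩ := hF
  set Q := (P⁻¹ : Matrix.SpecialLinearGroup (Fin 2) ℂ).1 with hQ
  have hQdet : Q.det = 1 := (P⁻¹).2
  have hdY : ∀ z ∈ puncturedDisc r, DifferentiableAt ℝ (X ∘ φ) z := fun z hz =>
    differentiableAt_of_contDiffOn (isOpen_puncturedDisc r) hX hz
  have hQR : (Q * R * Q.adjugate).det = R.det := by
    rw [Matrix.det_mul, Matrix.det_mul, Matrix.det_adjugate, hQdet]; simp
  have hQF : ∀ z ∈ puncturedDisc r, (Q * F z).det = 1 := fun z hz => by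
    rw [Matrix.det_mul, hQdet, hdet z hz, one_mul]
  have hadj : ∀ z, Q * F z * bryantMatrix g w z * (Q * F z).adjugate
      = Q * (F z * bryantMatrix g w z * (F z).adjugate) * Q.adjugate := fun z => by
    rw [Matrix.adjugate_mul_distrib]; simp only [Matrix.mul_assoc]
  have hQder : ∀ z ∈ puncturedDisc r ∩ Complex.slitPlane, ∀ i j,
      HasDerivAt (fun ξ => (Q * F ξ) i j) ((Q * F z * bryantMatrix g w z) i j) z := by
    intro z hz i j
    rw [Matrix.mul_assoc]
    have e : ∀ B : Matrix (Fin 2) (Fin 2) ℂ, (Q * B) i j = Q i 0 * B 0 j + Q i 1 * B 1 j :=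
      fun B => by rw [Matrix.mul_apply, Fin.sum_univ_two]
    simp only [e]
    exact ((hder z hz 0 j).const_mul _).add ((hder z hz 1 j).const_mul _)
  rcases hP with hP | hP
  · refine ⟨_, _, ⟨(hH.conj_mul Q Q.adjugate).differentiableOn,
      (hH.conj_mul Q Q.adjugate).hasDerivAt, fun z hz => ?_⟩, by rw [hQR]⟩
    rw [← (hH.conj_mul Q Q.adjugate).eq z hz, fluxForm_eq_of_toHerm_eq (hdY z hz.1) (hpos _)
      (G := fun z => Q * F z) ?_ (hQF z hz.1) (hQder z hz), hadj]
    filter_upwards [(isOpen_puncturedDisc r).mem_nhds hz.1] with ξ hξ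
    exact toHerm_eq_of_directIsometry_eq (hpos _) (hdet ξ hξ) (hP ξ hξ)
  -- For an indirect isometry `N = G G*` with `G(z)` the entrywise conjugate of `Q F(z̄)`. The two
  -- conjugations compensate each other, so `G` is holomorphic off the cut.
  · have hc := (hH.conj_mul Q Q.adjugate).map_conj
    refine ⟨_, _, ⟨hc.differentiableOn, hc.hasDerivAt, fun z hz => ?_⟩, ?_⟩
    · have hz' := conj_mem_puncturedDisc_slitPlane hz
      have hmem : ∀ ξ ∈ puncturedDisc r, starRingEnd ℂ ξ ∈ puncturedDisc r := fun ξ hξ => by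
        rw [mem_puncturedDisc] at hξ ⊢
        exact ⟨by simpa using hξ.1, by simpa using hξ.2⟩
      rw [← hc.eq z hz, fluxForm_eq_of_toHerm_eq (hdY z hz.1) (hpos _)
        (G := fun z => (Q * F (starRingEnd ℂ z)).map (starRingEnd ℂ))
        (W := (bryantMatrix g w (starRingEnd ℂ z)).map (starRingEnd ℂ)) ?_ ?_ ?_]
      · rw [← Matrix.map_mul, ← RingHom.mapMatrix_apply, ← RingHom.mapMatrix_apply,
          ← RingHom.map_adjugate, ← map_mul, hadj]
        rfl
      · filter_upwards [(isOpen_puncturedDisc r).mem_nhds hz.1] with ξ hξ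
        have h1 := toHerm_eq_of_directIsometry_eq (p := reflection (X (φ ξ))) (hpos _)
          (hdet _ (hmem ξ hξ)) (hP ξ hξ)
        rw [toHerm_reflection] at h1
        have h2 := congrArg (fun N : Matrix (Fin 2) (Fin 2) ℂ => N.map (starRingEnd ℂ)) h1
        simp only [Matrix.map_map, Matrix.map_mul] at h2
        have h3 : (toHerm (X (φ ξ))).map (starRingEnd ℂ ∘ starRingEnd ℂ) = toHerm (X (φ ξ)) := by
          ext i j; simp
        rw [h3] at h2
        rw [Function.comp_apply, h2]
        ext i j
        simp [Matrix.mul_apply, hQ]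
      · rw [← RingHom.mapMatrix_apply, ← RingHom.map_det, hQF _ hz'.1, map_one]
      · intro i j
        rw [← Matrix.map_mul]
        exact hasDerivAt_conj_comp_conj (hQder _ hz' i j)
    · rw [← RingHom.mapMatrix_apply, ← RingHom.map_det, hQR, map_eq_zero]

/-! ### Residues at the canonical ends -/

/-- The residue at a canonical catenoidal end is a nondegenerate matrix. -/
theorem IsCanonicalCatenoidal.exists_hasFluxResidue {μ r : ℝ} {F : ℂ → Matrix (Fin 2) (Fin 2) ℂ}
    (hr : 0 < r) (hF : IsCanonicalCatenoidal μ 0 r F) :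
    ∃ (g w : ℂ → ℂ) (H : ℂ → Matrix (Fin 2) (Fin 2) ℂ) (R : Matrix (Fin 2) (Fin 2) ℂ),
      IsBryantRepresentation F g w r ∧
      HasFluxResidue (fun z => F z * bryantMatrix g w z * (F z).adjugate) r H R ∧ R.det ≠ 0 := by
  obtain ⟨hμ, -, f₁, f₂, g₁, g₂, h, ⟨df₁, df₂, dg₁, dg₂, dh⟩, ⟨hf₁, hf₂, hg₁, hg₂, hh⟩, -, hFz,
    hrep⟩ := hF
  have hμC : (μ : ℂ) ≠ 0 := Complex.ofReal_ne_zero.2 hμ.ne'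
  have hμ1 : (μ : ℂ) + 1 ≠ 0 := by
    have : ((μ + 1 : ℝ) : ℂ) ≠ 0 := Complex.ofReal_ne_zero.2 (by linarith)
    simpa using this
  set κ : ℂ := ((μ : ℂ) - 1) / (μ + 1) with hκ
  set l : ℂ := ((μ : ℂ) ^ 2 - 1) / (4 * μ) with hl
  set ν : ℂ := (1 + (μ : ℂ)) ^ 2 / (4 * μ) with hν
  -- With these functions `a g + b = z^((1+μ)/2) p` and `c g + d = z^((μ-1)/2) q`. The flux form
  -- then has diagonal entry `p q h / z`, upper right entry `-p² h` and lower left entry `q² h /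
  -- z²`. Moreover `p(0) q(0) = μ`.
  set p : ℂ → ℂ := fun z => f₂ z + κ * g₂ z with hp
  set q : ℂ → ℂ := fun z => l * f₁ z + ν * g₁ z with hq
  have dp : DifferentiableOn ℂ p (ball 0 r) := df₂.add (dg₂.const_mul κ)
  have dq : DifferentiableOn ℂ q (ball 0 r) := (df₁.const_mul l).add (dg₁.const_mul ν)
  have h0 : ball (0 : ℂ) r ∈ 𝓝 0 := ball_mem_nhds _ hr
  have hp0 : p 0 ≠ 0 := by
    have : p 0 = 2 * μ / (μ + 1) := by
      simp only [hp, hf₂, hg₂, hκ]; field_simp; ring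
    rw [this]
    exact div_ne_zero (mul_ne_zero two_ne_zero hμC) hμ1
  have hq0 : q 0 ≠ 0 := by
    have : q 0 = (μ + 1) / 2 := by
      simp only [hq, hf₁, hg₁, hl, hν]; field_simp; ring
    rw [this]
    exact div_ne_zero hμ1 two_ne_zero
  have dk : DifferentiableOn ℂ (fun z => p z * q z * h z) (ball 0 r) := (dp.mul dq).mul dh
  have d1 : DifferentiableOn ℂ (fun z => z * (p z * q z * h z)) (ball 0 r) :=
    differentiableOn_id.mul dk
  have d2 : DifferentiableOn ℂ (fun z => z ^ 2 * (p z ^ 2 * h z)) (ball 0 r) :=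
    (differentiableOn_id.pow 2).mul ((dp.pow 2).mul dh)
  have d3 : DifferentiableOn ℂ (fun z => q z ^ 2 * h z) (ball 0 r) := (dq.pow 2).mul dh
  have e1 : HasDerivAt (fun z => z * (p z * q z * h z)) (p 0 * q 0 * h 0) 0 := by
    have := (hasDerivAt_id' (0 : ℂ)).fun_mul (dk.differentiableAt h0).hasDerivAt
    simpa using this
  have e2 : HasDerivAt (fun z => z ^ 2 * (p z ^ 2 * h z)) 0 0 := by
    have := (hasDerivAt_pow 2 (0 : ℂ)).fun_mul
      (((dp.pow 2).mul dh).differentiableAt h0).hasDerivAt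
    simpa using this
  -- The residue of the lower left entry need not be computed: the upper right one is zero, so the
  -- diagonal decides the determinant.
  refine ⟨_, _, fun z => !![z * (p z * q z * h z), -(z ^ 2 * (p z ^ 2 * h z));
    q z ^ 2 * h z, -(z * (p z * q z * h z))], !![p 0 * q 0 * h 0, -0;
    deriv (fun z => q z ^ 2 * h z) 0, -(p 0 * q 0 * h 0)], hrep, ⟨?_, ?_, ?_⟩, ?_⟩
  · intro i j
    fin_cases i <;> fin_cases j
    exacts [d1, d2.neg, d3, d1.neg]
  · intro i j
    fin_cases i <;> fin_cases j
    exacts [e1, e2.neg, (d3.differentiableAt h0).hasDerivAt, e1.neg]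
  · rintro z ⟨hz, -⟩
    have hz0 : z ≠ 0 := (mem_puncturedDisc.1 hz).2
    -- All the principal powers are rational in `t` and `s`, which turns the exponent identities
    -- into field identities.
    set t : ℂ := z ^ ((μ : ℂ) / 2) with ht
    set s : ℂ := z ^ ((1 : ℂ) / 2) with hs
    have ht0 : t ≠ 0 := by simp [ht, Complex.cpow_eq_zero_iff, hz0]
    have hs0 : s ≠ 0 := by simp [hs, Complex.cpow_eq_zero_iff, hz0]
    have hss : z = s * s := by
      rw [hs, ← Complex.cpow_add _ _ hz0]; norm_num
    have c1 : z ^ ((1 - (μ : ℂ)) / 2) = s / t := by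
      rw [hs, ht, ← Complex.cpow_sub _ _ hz0]; congr 1; ring
    have c2 : z ^ ((1 + (μ : ℂ)) / 2) = s * t := by
      rw [hs, ht, ← Complex.cpow_add _ _ hz0]; congr 1; ring
    have c3 : z ^ ((-1 - (μ : ℂ)) / 2) = (s * t)⁻¹ := by
      rw [← c2, ← Complex.cpow_neg]; congr 1; ring
    have c4 : z ^ (((μ : ℂ) - 1) / 2) = t / s := by
      rw [hs, ht, ← Complex.cpow_sub _ _ hz0]; congr 1; ring
    have c5 : z ^ (μ : ℂ) = t * t := by
      rw [ht, ← Complex.cpow_add _ _ hz0]; congr 1; ring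
    have c6 : z ^ (-1 - (μ : ℂ)) = (z * (t * t))⁻¹ := by
      rw [show -1 - (μ : ℂ) = -(1 + μ) by ring, Complex.cpow_neg, Complex.cpow_add _ _ hz0,
        Complex.cpow_one, c5]
    simp only [hFz z hz]
    rw [mul_bryantMatrix_mul_adjugate]
    simp only [c1, c2, c3, c4, c5, c6]
    have a1 : s / t * f₂ z * (t * t) + κ * (s * t) * g₂ z = s * t * p z := by
      simp only [hp]; field_simp
    have a2 : l * (s * t)⁻¹ * f₁ z * (t * t) + ν * (t / s) * g₁ z = t / s * q z := by
      simp only [hq]; field_simp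
    have k1 : (s * t * p z) * (t / s * q z) = t * t * (p z * q z) := by field_simp
    have k2 : (s * t * p z) ^ 2 = z * (t * t) * p z ^ 2 := by
      linear_combination -(t ^ 2 * p z ^ 2) * hss
    have k3 : (t / s * q z) ^ 2 = t * t * q z ^ 2 / z := by
      rw [eq_div_iff hz0]
      field_simp
      linear_combination q z ^ 2 * hss
    rw [a1, a2, k1, k2, k3]
    ext i j
    fin_cases i <;> fin_cases j <;> simp <;> field_simp
  · rw [Matrix.det_fin_two_of]
    have := mul_ne_zero (mul_ne_zero hp0 hq0) hh
    simpa using this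

/-- The residue at a canonical horospherical end is a degenerate matrix. -/
theorem IsCanonicalHorospherical.exists_hasFluxResidue {μ : ℕ} {r : ℝ}
    {F : ℂ → Matrix (Fin 2) (Fin 2) ℂ} (hr : 0 < r) (hF : IsCanonicalHorospherical μ r F) :
    ∃ (g w : ℂ → ℂ) (H : ℂ → Matrix (Fin 2) (Fin 2) ℂ) (R : Matrix (Fin 2) (Fin 2) ℂ),
      IsBryantRepresentation F g w r ∧
      HasFluxResidue (fun z => F z * bryantMatrix g w z * (F z).adjugate) r H R ∧ R.det = 0 := by
  obtain ⟨hμ, f₁, f₂, g₁, g₂, h, b, c, ⟨df₁, df₂, dg₁, dg₂, dh⟩, -, -, -, hFz, hrep⟩ := hF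
  obtain ⟨n, rfl⟩ := Nat.exists_eq_add_of_le' hμ
  have h0 : ball (0 : ℂ) r ∈ 𝓝 0 := ball_mem_nhds _ hr
  -- With `μ = n + 2`, `a g + b = z^(n+2) p` and `c g + d = q`. The bound `μ ≥ 2` makes the diagonal
  -- entry `z^n p q h` regular, and only the lower left entry `q² h / z²` has a pole.
  set p : ℂ → ℂ := fun z => f₂ z + b * z ^ (n + 1) * g₂ z with hp
  set q : ℂ → ℂ := fun z => c * z ^ (n + 1) * f₁ z + g₁ z with hq
  have dp : DifferentiableOn ℂ p (ball 0 r) := by fun_prop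
  have dq : DifferentiableOn ℂ q (ball 0 r) := by fun_prop
  have dsq : ∀ {f : ℂ → ℂ}, DifferentiableOn ℂ f (ball 0 r) →
      HasDerivAt (fun z => z ^ 2 * f z) 0 0 := fun hf => by
    have := (hasDerivAt_pow 2 (0 : ℂ)).fun_mul (hf.differentiableAt h0).hasDerivAt
    simpa using this
  have dk1 : DifferentiableOn ℂ (fun z => z ^ n * (p z * q z * h z)) (ball 0 r) := by fun_prop
  have dk2 : DifferentiableOn ℂ (fun z => z ^ (2 * n + 2) * (p z ^ 2 * h z)) (ball 0 r) := by
    fun_prop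
  have d3 : DifferentiableOn ℂ (fun z => q z ^ 2 * h z) (ball 0 r) := by fun_prop
  have d1 : DifferentiableOn ℂ (fun z => z ^ 2 * (z ^ n * (p z * q z * h z))) (ball 0 r) := by
    fun_prop
  have d2 : DifferentiableOn ℂ (fun z => z ^ 2 * (z ^ (2 * n + 2) * (p z ^ 2 * h z)))
      (ball 0 r) := by
    fun_prop
  refine ⟨_, _, fun z => !![z ^ 2 * (z ^ n * (p z * q z * h z)),
    -(z ^ 2 * (z ^ (2 * n + 2) * (p z ^ 2 * h z)));
    q z ^ 2 * h z, -(z ^ 2 * (z ^ n * (p z * q z * h z)))], !![0, -0;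
    deriv (fun z => q z ^ 2 * h z) 0, -0], hrep, ⟨?_, ?_, ?_⟩, ?_⟩
  · intro i j
    fin_cases i <;> fin_cases j
    exacts [d1, d2.neg, d3, d1.neg]
  · intro i j
    fin_cases i <;> fin_cases j
    exacts [dsq dk1, (dsq dk2).neg, (d3.differentiableAt h0).hasDerivAt, (dsq dk1).neg]
  · rintro z ⟨hz, -⟩
    have hz0 : z ≠ 0 := (mem_puncturedDisc.1 hz).2
    simp only [hFz z hz]
    rw [mul_bryantMatrix_mul_adjugate]
    have a1 : f₂ z * z ^ (n + 2) + b * z ^ (2 * (n + 2) - 1) * g₂ z = z ^ (n + 2) * p z := by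
      have : 2 * (n + 2) - 1 = (n + 2) + (n + 1) := by omega
      simp only [hp, this, pow_add]; ring
    have a2 : c * z⁻¹ * f₁ z * z ^ (n + 2) + g₁ z = q z := by
      have : z ^ (n + 2) = z * z ^ (n + 1) := by ring
      simp only [hq, this]; field_simp
    rw [a1, a2]
    ext i j
    fin_cases i <;> fin_cases j <;> simp <;> field_simp <;> ring
  · simp [Matrix.det_fin_two_of]

/-! ### The flux of a Bryant surface -/

section Flux

variable {M : Type*} [TopologicalSpace M] [ChartedSpace ℂ M] [IsManifold 𝓘(ℂ) ω M]

/-- The entries of the flux form of a Bryant surface are holomorphic forms. -/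
def IsBryantImmersion.fluxHolomorphicForm {X : M → ℂ × ℝ} (hX : IsBryantImmersion X)
    (i j : Fin 2) : HolomorphicForm M where
  coeff c z := fluxForm (X ∘ c.symm) z i j
  differentiableOn c hc := differentiableOn_fluxForm c.open_target
    (contDiffOn_comp_symm hX.smooth hc) (fun _ _ => hX.mem_halfSpace _) (hX.conformal c hc)
    (hX.meanCurvature_eq_one c hc) i j
  compat c hc c' hc' z hz hzc := by
    have hφ := isHolomorphicParam_symm (M := M) hc
    rw [fluxForm_congr (hφ.comp_eventuallyEq X hz hzc), fluxForm_comp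
      (differentiableAt_of_contDiffOn c'.open_target (contDiffOn_comp_symm hX.smooth hc')
        (c'.map_source hzc)) (hφ.differentiableAt hc' hz hzc)]
    simp

theorem IsBryantImmersion.isCoeff_fluxForm {X : M → ℂ × ℝ} (hX : IsBryantImmersion X)
    {φ : ℂ → M} {U : Set ℂ} (hφ : IsHolomorphicParam φ U) (i j : Fin 2) :
    (hX.fluxHolomorphicForm i j).IsCoeff φ U fun z => fluxForm (X ∘ φ) z i j := by
  intro c hc z hz hzc
  simp only [fluxHolomorphicForm]
  rw [fluxForm_congr (hφ.comp_eventuallyEq X hz hzc), fluxForm_comp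
    (differentiableAt_of_contDiffOn c.open_target (contDiffOn_comp_symm hX.smooth hc)
      (c.map_source hzc)) (hφ.differentiableAt hc hz hzc)]
  simp

theorem IsCatenoidalEnd.exists_hasFluxResidue {X : M → ℂ × ℝ} (hX : IsBryantImmersion X)
    {e : Filter M} (he : IsCatenoidalEnd X e) :
    ∃ φ r H R, IsEndParam e φ r ∧ HasFluxResidue (fluxForm (X ∘ φ)) r H R ∧ R.det ≠ 0 := by
  obtain ⟨-, -, μ, r, F, hF, P, φ, hφ, hP⟩ := he
  obtain ⟨g, w, H, R, hrep, hres, hdet⟩ := hF.exists_hasFluxResidue hφ.radius_pos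
  obtain ⟨H', R', hres', hiff⟩ := exists_hasFluxResidue_of_isometric hrep
    (hφ.isHolomorphicParam.contDiffOn_comp hX.smooth) hX.mem_halfSpace hP hres
  exact ⟨φ, r, H', R', hφ, hres', fun h => hdet (hiff.1 h)⟩

theorem IsHorosphericalEnd.exists_hasFluxResidue {X : M → ℂ × ℝ} (hX : IsBryantImmersion X)
    {e : Filter M} (he : IsHorosphericalEnd X e) :
    ∃ φ r H R, IsEndParam e φ r ∧ HasFluxResidue (fluxForm (X ∘ φ)) r H R ∧ R.det = 0 := by
  obtain ⟨-, -, μ, r, F, hF, P, φ, hφ, hP⟩ := he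
  obtain ⟨g, w, H, R, hrep, hres, hdet⟩ := hF.exists_hasFluxResidue hφ.radius_pos
  obtain ⟨H', R', hres', hiff⟩ := exists_hasFluxResidue_of_isometric hrep
    (hφ.isHolomorphicParam.contDiffOn_comp hX.smooth) hX.mem_halfSpace hP hres
  exact ⟨φ, r, H', R', hφ, hres', hiff.2 hdet⟩

/-- The residues of the flux form at the two ends of a Bryant surface are opposite. -/
theorem residue_add_residue_eq_zero [T2Space M] {X : M → ℂ × ℝ} (hX : IsBryantImmersion X)
    {e : Fin 2 → Filter M} (hd : Pairwise fun k l => Disjoint (e k) (e l))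
    (hex : cocompact M ≤ ⨆ k, e k) {φ : Fin 2 → ℂ → M} {r : Fin 2 → ℝ}
    (hφ : ∀ k, IsEndParam (e k) (φ k) (r k)) {H : Fin 2 → ℂ → Matrix (Fin 2) (Fin 2) ℂ}
    {R : Fin 2 → Matrix (Fin 2) (Fin 2) ℂ}
    (hR : ∀ k, HasFluxResidue (fluxForm (X ∘ φ k)) (r k) (H k) (R k)) : R 0 + R 1 = 0 := by
  ext i j
  have h := sum_residue_eq_zero (hX.fluxHolomorphicForm i j) hφ hd hex
    (fun k => hX.isCoeff_fluxForm (hφ k).isHolomorphicParam i j)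
    (fun k => (hR k).differentiableOn i j) (fun k z hz => by
      rw [(hR k).eq z hz]
      simp [div_eq_inv_mul])
  rw [Fin.sum_univ_two, ((hR 0).hasDerivAt i j).deriv, ((hR 1).hasDerivAt i j).deriv] at h
  exact h

end Flux

end BryantFlux

/-! ### Comparison of the two residues -/

theorem mainTheorem12 {M : Type*} [TopologicalSpace M] [T2Space M] [ChartedSpace ℂ M]
    [IsManifold 𝓘(ℂ) ω M] (X : M → ℂ × ℝ) (e : Fin 2 → Filter M)
    (hX : BryantFlux.IsCatenoidalSurface 2 X e) :
    ¬ ∃ i j : Fin 2, i ≠ j ∧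
      BryantFlux.IsCatenoidalEnd X (e i) ∧ BryantFlux.IsHorosphericalEnd X (e j) := by
  rintro ⟨i, j, hij, hi, hj⟩
  obtain ⟨φ₁, r₁, H₁, R₁, hφ₁, hR₁, hdet₁⟩ := hi.exists_hasFluxResidue hX.bryant
  obtain ⟨φ₂, r₂, H₂, R₂, hφ₂, hR₂, hdet₂⟩ := hj.exists_hasFluxResidue hX.bryant
  -- The ends are reindexed so that the catenoidal one comes first.
  have hd : Pairwise fun k l => Disjoint ((![e i, e j] : Fin 2 → Filter M) k)
      ((![e i, e j] : Fin 2 → Filter M) l) := by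
    intro k l hkl
    fin_cases k <;> fin_cases l
    exacts [absurd rfl hkl, hX.ends_disjoint hij, hX.ends_disjoint hij.symm, absurd rfl hkl]
  have hex : Filter.cocompact M ≤ ⨆ k, (![e i, e j] : Fin 2 → Filter M) k := by
    rw [hX.ends_exhaust]
    refine iSup_le fun k => ?_
    rcases (show k = i ∨ k = j by omega) with rfl | rfl
    · exact le_iSup (![e k, e j] : Fin 2 → Filter M) 0
    · exact le_iSup (![e i, e k] : Fin 2 → Filter M) 1
  have h := BryantFlux.residue_add_residue_eq_zero hX.bryant hd hex (φ := ![φ₁, φ₂])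
    (r := ![r₁, r₂]) (fun k => by fin_cases k; exacts [hφ₁, hφ₂]) (H := ![H₁, H₂])
    (R := ![R₁, R₂]) (fun k => by fin_cases k; exacts [hR₁, hR₂])
  have h' : R₁ = -R₂ := eq_neg_of_add_eq_zero_left h
  -- `R₁ = -R₂` has determinant `(-1)² det R₂ = 0`, against the nondegeneracy of the catenoidal
  -- residue.
  refine hdet₁ ?_
  rw [h', Matrix.det_neg, hdet₂, mul_zero]

end
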